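/- **Theorem.** Consider the following triply periodic polyhedral surfaces in $\mathbb{R}^3$, each modulo its lattice $\Lambda$ of translations; all faces are regarded as regular polygons with sides of length $1$, and $\{p,q\}$ means that the surface is tiled by $p$-gons, $q$ at every vertex. * *Mucube* $\{4,6\}$ ($12$ faces modulo $\Lambda=2\mathbb{Z}^3$): the boundary of the union of unit cubes placed at the points of $2\mathbb{Z}^3$ and of the cubes (square prisms) that join neighbouring ones along faces. * *Muoctahedron* $\{6,4\}$ ($8$ faces modulo $\Lambda=4\mathbb{Z}^3$): the hexagons of the truncated octahedra, with vertices the permutations of $(0,\pm1,\pm2)$, centred at the points of $4\mathbb{Z}^3$; neighbouring ones meet along squares. * *Mutetrahedron* $\{6,6\}$ ($4$ faces modulo $\Lambda$, the face-centred cubic lattice generated by $(0,4,4),(4,0,4),(4,4,0)$): the hexagons of the truncated tetrahedra, with vertices the permutations of $(\pm1,\pm1,\pm3)$ with an even number of minus signs, centred at the points of $\Lambda$; these are joined by tetrahedra along triangles. * *Octa-4* $\{3,8\}$ ($32$ faces modulo $\Lambda$): the boundary of the union of regular octahedra placed at the vertices of the diamond net and of the triangular antiprisms along its edges that join them along faces.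 * *Truncated Octa-8* $\{4,5\}$ ($30$ faces modulo $\Lambda$): the boundary of the union of truncated octahedra placed at the points of a body-centred cubic lattice $\Lambda$ and of the hexagonal prisms that join them along their hexagons. The *translation cover* of such a surface is a connected component of the translation surface obtained from copies of $X=\Pi/\Lambda$, rotated by the multiples of $2\pi/N$ ($N=4$ for square faces, $N=6$ for triangles and hexagons), by gluing their polygons along corresponding parallel sides by translations. For square faces it is tiled by unit squares. Otherwise (after dividing every hexagon into six triangles) it is tiled by rhombi consisting of two triangles, with sides $1$ and $\zeta$, and it is made square-tiled by the real linear map with $1\mapsto 1$, $\zeta\mapsto i$; here $\zeta=e^{\pi i/3}$ for Mutetrahedron and $\zeta=e^{2\pi i/3}$ for Muoctahedron and Octa-4. For each of these square-tiled translation surfaces (whichever component is chosen) the Veech group, that is, the stabilizer of the translation surface in $SL(2,\mathbb{R})$, is a subgroup $\Gamma$ of finite index in $SL(2,\mathbb{Z})$. The index, representatives of the cusps (the orbits of $\Gamma$ on $\mathbb{Q}\cup\{\infty\}$ under Möbius transformations, each listed exactly once), and the corresponding cusp widths are | | Index | Cusps | Cusp widths | |---|---|---|---| | Mucube | $9$ |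 $\infty,\ 1/2,\ 1$ | $4,\ 2,\ 3$ | | Muoctahedron | $16$ | $\infty,\ 1/5,\ 1/2,\ 1/7$ | $9,\ 1,\ 3,\ 3$ | | Mutetrahedron | $4$ | $\infty,\ 1$ | $3,\ 1$ | | Octa-4 | $4$ | $\infty,\ 1/2$ | $3,\ 1$ | | Truncated Octa-8 | $15$ | $\infty,\ 3,\ 1,\ 4$ | $6,\ 2,\ 3,\ 4$ | Here the width of the cusp $g\cdot\infty$, $g\in SL(2,\mathbb{Z})$, is the least $n>0$ with $\pm g\begin{pmatrix}1&n\\0&1\end{pmatrix}g^{-1}\in\Gamma$. -/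

import Mathlib

open scoped MatrixGroups

/-! ### Square-tiled surfaces and their Veech groups -/

/-- A square-tiled surface given by its horizontal and vertical permutations: the right side of the
square `i` is glued to the left side of the square `h i`, the top of the square `i` is glued to the
bottom of the square `v i`. -/
structure SquareTiled (ι : Type) where
  h : Equiv.Perm ι
  v : Equiv.Perm ι

namespace SquareTiled

/-- The closed unit square in the plane. -/
abbrev Square : Type := Set.Icc (0 : Fin 2 → ℝ) 1

variable {ι : Type} (O : SquareTiled ι)

/-- The gluing of the sides of the squares by translations. -/
inductive Glue : (Σ _ : ι, Square) → (Σ _ : ι, Square) → Prop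
  | right (i : ι) (p q : Square) (hp : p.1 0 = 1) (hq : q.1 0 = 0) (hpq : p.1 1 = q.1 1) :
      Glue ⟨i, p⟩ ⟨O.h i, q⟩
  | top (i : ι) (p q : Square) (hp : p.1 1 = 1) (hq : q.1 1 = 0) (hpq : p.1 0 = q.1 0) :
      Glue ⟨i, p⟩ ⟨O.v i, q⟩

/-- The surface obtained from the disjoint union of the squares, with the quotient topology. -/
abbrev Surface : Type := Quot O.Glue

/-- The point `p` of the square `i`, as a point of the surface. -/
def point (i : ι) (p : Square) : O.Surface := Quot.mk _ ⟨i, p⟩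

/-- `φ` is, on the open set `U`, a primitive of the holomorphic one-form `ω` of the surface, which
is `dz` on every square (`ℂ` is identified with `ℝ²`). Near a point that is not a zero of
`ω` such functions are exactly the translation charts of the surface (up to restriction). -/
def IsPrimitive (U : Set O.Surface) (φ : O.Surface → (Fin 2 → ℝ)) : Prop :=
  ∀ (i : ι) (p : Square), O.point i p ∈ U →
    ∀ᶠ q in nhds p, φ (O.point i q) - φ (O.point i p) = q.1 - p.1

/-- The homeomorphism `f` is affine with derivative `A`, that is, it is an isomorphism of
translation surfaces from `A • (X, ω)` to `(X, ω)`: it pulls the local primitives of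
`ω` back to `A` composed with the local primitives of `ω`. -/
def IsAffine (A : SL(2, ℝ)) (f : O.Surface ≃ₜ O.Surface) : Prop :=
  ∀ (U : Set O.Surface) (φ : O.Surface → (Fin 2 → ℝ)), IsOpen U →
    (O.IsPrimitive (f '' U) φ ↔
      O.IsPrimitive U (fun x => ((A⁻¹ : SL(2, ℝ)) : Matrix (Fin 2) (Fin 2) ℝ).mulVec (φ (f x))))

/-- The Veech group: the stabilizer of the translation surface under the action of `SL(2, ℝ)`,
that is, the group of derivatives of its affine homeomorphisms. -/
def veechGroup : Subgroup SL(2, ℝ) where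
  carrier := {A | ∃ f : O.Surface ≃ₜ O.Surface, O.IsAffine A f}
  one_mem' := ⟨Homeomorph.refl _, fun U φ _ => by simp⟩
  mul_mem' := by
    rintro A B ⟨f, hf⟩ ⟨g, hg⟩
    refine ⟨g.trans f, fun U φ hU => ?_⟩
    have h1 := hf (g '' U) φ (g.isOpenMap U hU)
    have h2 := hg U (fun x => ((A⁻¹ : SL(2, ℝ)) : Matrix (Fin 2) (Fin 2) ℝ).mulVec (φ (f x))) hU
    rw [Set.image_image] at h1
    simp only [mul_inv_rev, Matrix.SpecialLinearGroup.coe_mul, ← Matrix.mulVec_mulVec]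
    exact h1.trans h2
  inv_mem' := by
    rintro A ⟨f, hf⟩
    refine ⟨f.symm, fun U φ hU => ?_⟩
    have h := hf (f.symm '' U)
      (fun x => (A : Matrix (Fin 2) (Fin 2) ℝ).mulVec (φ (f.symm x))) (f.symm.isOpenMap U hU)
    have e : ∀ w : Fin 2 → ℝ, ((A⁻¹ : SL(2, ℝ)) : Matrix (Fin 2) (Fin 2) ℝ).mulVec
        ((A : Matrix (Fin 2) (Fin 2) ℝ).mulVec w) = w := fun w => by
      rw [Matrix.mulVec_mulVec, ← Matrix.SpecialLinearGroup.coe_mul]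
      simp
    simp only [Set.image_image, Homeomorph.apply_symm_apply, Set.image_id',
      Homeomorph.symm_apply_apply, e] at h
    simpa only [inv_inv] using h.symm

/-- The squares that can be reached from the square `i` by crossing sides. -/
def tiles (i : ι) : Set ι := MulAction.orbit (Subgroup.closure {O.h, O.v}) i

lemma mem_tiles_iff (i : ι) {σ : Equiv.Perm ι} (hσ : σ ∈ Subgroup.closure {O.h, O.v}) (j : ι) :
    σ j ∈ O.tiles i ↔ j ∈ O.tiles i := by
  have h : MulAction.orbit (Subgroup.closure {O.h, O.v}) (σ j) =
      MulAction.orbit (Subgroup.closure {O.h, O.v}) j :=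
    MulAction.orbit_smul (⟨σ, hσ⟩ : Subgroup.closure {O.h, O.v}) j
  unfold tiles
  rw [← MulAction.orbit_eq_iff, h, MulAction.orbit_eq_iff]

/-- The connected component of the square `i`. -/
def component (i : ι) : SquareTiled (O.tiles i) where
  h := O.h.subtypePerm (O.mem_tiles_iff i (Subgroup.subset_closure (by simp)))
  v := O.v.subtypePerm (O.mem_tiles_iff i (Subgroup.subset_closure (by simp)))

end SquareTiled

/-! ### Cusps -/

/-- `L` lists the cusps and the cusp widths of the subgroup `Γ` of `SL(2, ℤ)`: the first components
are representatives of the `Γ`-orbits of cusps, one for every orbit; the second components are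
the widths. Here `Γ` acts by Moebius transformations, and the width of the cusp `g • ∞`, where `g`
lies in `SL(2, ℤ)`, is the least `n > 0` such that `g T ^ n g⁻¹` or its negative lies in `Γ`. -/
structure IsCuspTable (Γ : Subgroup SL(2, ℤ)) (L : List (OnePoint ℝ × ℕ)) : Prop where
  card_eq : Nat.card (CuspOrbits (Γ : Subgroup (GL (Fin 2) ℝ))) = L.length
  isCusp : ∀ e ∈ L, IsCusp e.1 (Γ : Subgroup (GL (Fin 2) ℝ))
  existsUnique : ∀ c : OnePoint ℝ, IsCusp c (Γ : Subgroup (GL (Fin 2) ℝ)) →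
    ∃! e, e ∈ L ∧ ∃ γ ∈ (Γ : Subgroup (GL (Fin 2) ℝ)), γ • e.1 = c
  width : ∀ e ∈ L, ∀ g : SL(2, ℤ), Matrix.SpecialLinearGroup.mapGL ℝ g • OnePoint.infty = e.1 →
    IsLeast {n : ℕ | 0 < n ∧
      (g * ModularGroup.T ^ n * g⁻¹ ∈ Γ ∨ -(g * ModularGroup.T ^ n * g⁻¹) ∈ Γ)} e.2

/-- The Veech group of the square-tiled surface `O` is a subgroup of `SL(2, ℤ)` of index `n` with
the cusps and cusp widths listed in `L`. -/
def HasVeechData {ι : Type} (O : SquareTiled ι) (n : ℕ) (L : List (OnePoint ℝ × ℕ)) : Prop :=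
  ∃ Γ : Subgroup SL(2, ℤ),
    O.veechGroup = Γ.map (Matrix.SpecialLinearGroup.map (Int.castRingHom ℝ)) ∧
    Γ.FiniteIndex ∧ Γ.index = n ∧ IsCuspTable Γ L

/-! ### Polygonal surfaces and their translation covers -/

/-- A closed oriented surface glued from polygons, given by its darts (the sides of the polygons,
oriented counterclockwise): `next d` follows `d` on the boundary of its polygon, and `opp d` is the
side that is glued to `d` (with the opposite orientation). -/
structure DartMap (D : Type) where
  next : Equiv.Perm D
  opp : Equiv.Perm D

namespace DartMap

variable {D : Type} (M : DartMap D)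

/-- Every polygon is divided into triangles by joining its centre to its vertices. The triangle on
the side `d` has the sides `(d, 0)`, which is `d` itself, `(d, 1)` from the end point of `d` to the
centre, and `(d, 2)` from the centre to the initial point of `d`. -/
def subdivide : DartMap (D × Fin 3) where
  next := (Equiv.refl D).prodCongr (Equiv.addRight 1)
  opp :=
    { toFun := fun x => match x with
        | (d, 0) => (M.opp d, 0)
        | (d, 1) => (M.next d, 2)
        | (d, 2) => (M.next.symm d, 1)
      invFun := fun x => match x with
        | (d, 0) => (M.opp.symm d, 0)
        | (d, 1) => (M.next d, 2)
        | (d, 2) => (M.next.symm d, 1)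
      left_inv := by rintro ⟨d, i⟩; fin_cases i <;> simp
      right_inv := by rintro ⟨d, i⟩; fin_cases i <;> simp }

/-- The unfolding of a surface glued from unit-length regular `p`-gons, where `p` divides the even
number `N`: we take `N` copies of the surface, turned by the multiples of `2 * π / N`, and glue their
polygons along parallel sides by translations. The dart `(d, θ)` is the copy of `d` that has the
direction `2 * π * θ / N`. The connected components of the unfolding are the translation covers of
the surface; they differ by rotations only. -/
def unfold (N p : ℕ) : DartMap (D × ZMod N) where
  next := M.next.prodCongr (Equiv.addRight ((N / p : ℕ) : ZMod N))
  opp := M.opp.prodCongr (Equiv.addRight ((N / 2 : ℕ) : ZMod N))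

/-- The square-tiled surface of an unfolding by unit squares (`N = p = 4`). A square is named by its
lower side, the dart of direction `0`. We leave it through its right side, respectively its top, and
go to the lower side of the square reached. -/
def squares (M : DartMap D) : SquareTiled D where
  h := M.next * M.opp * M.next
  v := M.opp * M.next * M.next

/-- The square-tiled surface of an unfolding by equilateral triangles (`N = 6`, `p = 3`), which are
paired to rhombi with the sides `1` and `exp (π * I / 3)`; the linear map that sends these to `1` and
`I` makes the rhombi unit squares. A rhombus is named by its lower side, the dart of direction `0`.
The upper right half of the rhombus is the triangle across the side of direction `π * 2 / 3`. -/
def rhombi60 (M : DartMap D) : SquareTiled D where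
  h := M.next * M.opp * M.next * M.opp * M.next
  v := M.opp * M.next * M.next * M.opp * M.next

/-- The same with rhombi with the sides `1` and `exp (2 * π * I / 3)`, which are sent to `1` and
`I`. The upper left half of the rhombus is the triangle across the side of direction `π * 4 / 3`
of the triangle on the lower side. -/
def rhombi120 (M : DartMap D) : SquareTiled D where
  h := M.next * M.opp * M.next * M.opp * M.next
  v := M.opp * M.next * M.opp * M.next * M.next

end DartMap

/-! ### Triply periodic polyhedral surfaces -/

/-- The lattice `n ℤ³`. -/
def cubicLattice (n : ℤ) : AddSubgroup (ℤ × ℤ × ℤ) where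
  carrier := {x | n ∣ x.1 ∧ n ∣ x.2.1 ∧ n ∣ x.2.2}
  zero_mem' := by simp
  add_mem' := fun ha hb => ⟨dvd_add ha.1 hb.1, dvd_add ha.2.1 hb.2.1, dvd_add ha.2.2 hb.2.2⟩
  neg_mem' := fun ha => by simpa using ha

/-- The face-centred cubic lattice generated by `n (0, 1, 1)`, `n (1, 0, 1)` and `n (1, 1, 0)`. -/
def fccLattice (n : ℤ) : AddSubgroup (ℤ × ℤ × ℤ) where
  carrier := {x | n ∣ x.1 ∧ n ∣ x.2.1 ∧ n ∣ x.2.2 ∧ 2 * n ∣ x.1 + x.2.1 + x.2.2}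
  zero_mem' := by simp
  add_mem' := fun {a b} ha hb => ⟨dvd_add ha.1 hb.1, dvd_add ha.2.1 hb.2.1,
    dvd_add ha.2.2.1 hb.2.2.1, by
      have h := dvd_add ha.2.2.2 hb.2.2.2
      rwa [show a.1 + a.2.1 + a.2.2 + (b.1 + b.2.1 + b.2.2) =
        (a + b).1 + (a + b).2.1 + (a + b).2.2 by simp; ring] at h⟩
  neg_mem' := fun {a} ha => ⟨(dvd_neg).2 ha.1, (dvd_neg).2 ha.2.1, (dvd_neg).2 ha.2.2.1, by
      have h := (dvd_neg).2 ha.2.2.2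
      rwa [show -(a.1 + a.2.1 + a.2.2) = (-a).1 + (-a).2.1 + (-a).2.2 by simp; ring] at h⟩

/-- The body-centred cubic lattice generated by the vectors `n (±1, ±1, ±1)`. -/
def bccLattice (n : ℤ) : AddSubgroup (ℤ × ℤ × ℤ) where
  carrier := {x | n ∣ x.1 ∧ 2 * n ∣ x.1 - x.2.1 ∧ 2 * n ∣ x.1 - x.2.2}
  zero_mem' := by simp
  add_mem' := fun {a b} ha hb => ⟨dvd_add ha.1 hb.1, by
      have h := dvd_add ha.2.1 hb.2.1
      rwa [show a.1 - a.2.1 + (b.1 - b.2.1) = (a + b).1 - (a + b).2.1 by simp; ring] at h, by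
      have h := dvd_add ha.2.2 hb.2.2
      rwa [show a.1 - a.2.2 + (b.1 - b.2.2) = (a + b).1 - (a + b).2.2 by simp; ring] at h⟩
  neg_mem' := fun {a} ha => ⟨(dvd_neg).2 ha.1, by
      have h := (dvd_neg).2 ha.2.1
      rwa [show -(a.1 - a.2.1) = (-a).1 - (-a).2.1 by simp; ring] at h, by
      have h := (dvd_neg).2 ha.2.2
      rwa [show -(a.1 - a.2.2) = (-a).1 - (-a).2.2 by simp; ring] at h⟩

instance (n : ℤ) : DecidablePred (· ∈ cubicLattice n) := fun x =>
  inferInstanceAs (Decidable (n ∣ x.1 ∧ n ∣ x.2.1 ∧ n ∣ x.2.2))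

instance (n : ℤ) : DecidablePred (· ∈ fccLattice n) := fun x =>
  inferInstanceAs (Decidable (n ∣ x.1 ∧ n ∣ x.2.1 ∧ n ∣ x.2.2 ∧ 2 * n ∣ x.1 + x.2.1 + x.2.2))

instance (n : ℤ) : DecidablePred (· ∈ bccLattice n) := fun x =>
  inferInstanceAs (Decidable (n ∣ x.1 ∧ 2 * n ∣ x.1 - x.2.1 ∧ 2 * n ∣ x.1 - x.2.2))

/-- Let the vectors `face i j` be the vertices of polygons in space with `p` sides, in
counterclockwise order as seen from one side of the surface formed by their translates under the
lattice `Λ`. The sides `e` and `e'` are glued in the quotient by `Λ` if a vector of `Λ` translates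
`e` to `e'` with the opposite orientation. Here `(i, j)` is the side from `face i j` to
`face i (j + 1)`. -/
def SidesMatch {m p : ℕ} [NeZero p] (face : Fin m → Fin p → ℤ × ℤ × ℤ)
    (Λ : AddSubgroup (ℤ × ℤ × ℤ)) (e e' : Fin m × Fin p) : Prop :=
  face e'.1 (e'.2 + 1) - face e'.1 e'.2 = face e.1 e.2 - face e.1 (e.2 + 1) ∧
    face e'.1 e'.2 - face e.1 (e.2 + 1) ∈ Λ

instance {m p : ℕ} [NeZero p] (face : Fin m → Fin p → ℤ × ℤ × ℤ)
    (Λ : AddSubgroup (ℤ × ℤ × ℤ)) [DecidablePred (· ∈ Λ)] (e e' : Fin m × Fin p) :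
    Decidable (SidesMatch face Λ e e') :=
  inferInstanceAs (Decidable (_ ∧ _))

/-- A triply periodic polyhedral surface with `m` faces modulo its lattice `Λ` of translations, all
of them `p`-gons: the translates of the faces under `Λ` form the surface, and `opp` is the gluing of the
sides modulo `Λ`. -/
structure PeriodicSurface (m p : ℕ) [NeZero p] where
  face : Fin m → Fin p → ℤ × ℤ × ℤ
  Λ : AddSubgroup (ℤ × ℤ × ℤ)
  opp : Equiv.Perm (Fin m × Fin p)
  opp_match : ∀ e, SidesMatch face Λ e (opp e)

/-- The quotient by the lattice, as a surface glued from polygons. The polygons are regarded as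
regular with unit sides. -/
def PeriodicSurface.toDartMap {m p : ℕ} [NeZero p] (S : PeriodicSurface m p) :
    DartMap (Fin m × Fin p) where
  next := (Equiv.refl (Fin m)).prodCongr (Equiv.addRight 1)
  opp := S.opp

/-- Mucube `{4, 6}`: at the points of `2 ℤ³` there are unit cubes, joined by unit cubes (square
prisms) along their faces. The faces are the free sides of the prisms. -/
def mucubeFace : Fin 12 → Fin 4 → ℤ × ℤ × ℤ :=
  ![![(1, 0, 0), (2, 0, 0), (2, 0, 1), (1, 0, 1)],
    ![(1, 1, 0), (1, 1, 1), (2, 1, 1), (2, 1, 0)],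
    ![(1, 0, 0), (1, 1, 0), (2, 1, 0), (2, 0, 0)],
    ![(1, 0, 1), (2, 0, 1), (2, 1, 1), (1, 1, 1)],
    ![(0, 1, 0), (0, 1, 1), (0, 2, 1), (0, 2, 0)],
    ![(1, 1, 0), (1, 2, 0), (1, 2, 1), (1, 1, 1)],
    ![(0, 1, 0), (0, 2, 0), (1, 2, 0), (1, 1, 0)],
    ![(0, 1, 1), (1, 1, 1), (1, 2, 1), (0, 2, 1)],
    ![(0, 0, 1), (0, 0, 2), (0, 1, 2), (0, 1, 1)],
    ![(1, 0, 1), (1, 1, 1), (1, 1, 2), (1, 0, 2)],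
    ![(0, 0, 1), (1, 0, 1), (1, 0, 2), (0, 0, 2)],
    ![(0, 1, 1), (0, 1, 2), (1, 1, 2), (1, 1, 1)]]

/-- The gluing of the sides of Mucube: side `j` of face `i` is glued to the listed side. -/
def mucubeOpp : Fin 12 → Fin 4 → Fin 12 × Fin 4 :=
  ![![(2, 3), (4, 2), (3, 0), (5, 1)],
    ![(5, 3), (3, 2), (4, 0), (2, 1)],
    ![(9, 2), (1, 3), (8, 1), (0, 0)],
    ![(0, 2), (8, 3), (1, 1), (9, 0)],
    ![(1, 2), (7, 3), (0, 1), (6, 0)],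
    ![(6, 2), (0, 3), (7, 1), (1, 0)],
    ![(4, 3), (10, 2), (5, 0), (11, 1)],
    ![(11, 3), (5, 2), (10, 0), (4, 1)],
    ![(10, 3), (2, 2), (11, 0), (3, 1)],
    ![(3, 3), (11, 2), (2, 0), (10, 1)],
    ![(7, 2), (9, 3), (6, 1), (8, 0)],
    ![(8, 2), (6, 3), (9, 1), (7, 0)]]

/-- Mucube. -/
def mucube : PeriodicSurface 12 4 where
  face := mucubeFace
  Λ := cubicLattice 2
  opp := ⟨fun e => mucubeOpp e.1 e.2, fun e => mucubeOpp e.1 e.2,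
    by decide +kernel, by decide +kernel⟩
  opp_match := by decide +kernel

/-- Muoctahedron `{6, 4}`: truncated octahedra, centred at the points of `4 ℤ³`, with the vertices
`(0, ±1, ±2)` and their permutations, meet along their square faces. The faces are the
hexagons of the truncated octahedra. -/
def muoctahedronFace : Fin 8 → Fin 6 → ℤ × ℤ × ℤ :=
  ![![(2, 1, 0), (1, 2, 0), (0, 2, 1), (0, 1, 2), (1, 0, 2), (2, 0, 1)],
    ![(2, 1, 0), (2, 0, -1), (1, 0, -2), (0, 1, -2), (0, 2, -1), (1, 2, 0)],
    ![(0, -2, 1), (1, -2, 0), (2, -1, 0), (2, 0, 1), (1, 0, 2), (0, -1, 2)],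
    ![(0, -2, -1), (0, -1, -2), (1, 0, -2), (2, 0, -1), (2, -1, 0), (1, -2, 0)],
    ![(-1, 0, 2), (0, 1, 2), (0, 2, 1), (-1, 2, 0), (-2, 1, 0), (-2, 0, 1)],
    ![(0, 2, -1), (0, 1, -2), (-1, 0, -2), (-2, 0, -1), (-2, 1, 0), (-1, 2, 0)],
    ![(0, -2, 1), (0, -1, 2), (-1, 0, 2), (-2, 0, 1), (-2, -1, 0), (-1, -2, 0)],
    ![(0, -2, -1), (-1, -2, 0), (-2, -1, 0), (-2, 0, -1), (-1, 0, -2), (0, -1, -2)]]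

/-- The gluing of the sides of Muoctahedron: side `j` of face `i` is glued to the listed side. -/
def muoctahedronOpp : Fin 8 → Fin 6 → Fin 8 × Fin 6 :=
  ![![(1, 5), (2, 0), (4, 1), (1, 2), (2, 3), (4, 4)],
    ![(5, 3), (3, 2), (0, 3), (5, 0), (3, 5), (0, 0)],
    ![(0, 1), (3, 4), (6, 3), (0, 4), (3, 1), (6, 0)],
    ![(7, 5), (2, 4), (1, 1), (7, 2), (2, 1), (1, 4)],
    ![(5, 1), (0, 2), (6, 5), (5, 4), (0, 5), (6, 2)],
    ![(1, 3), (4, 0), (7, 3), (1, 0), (4, 3), (7, 0)],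
    ![(2, 5), (7, 4), (4, 5), (2, 2), (7, 1), (4, 2)],
    ![(5, 5), (6, 4), (3, 3), (5, 2), (6, 1), (3, 0)]]

/-- Muoctahedron. -/
def muoctahedron : PeriodicSurface 8 6 where
  face := muoctahedronFace
  Λ := cubicLattice 4
  opp := ⟨fun e => muoctahedronOpp e.1 e.2, fun e => muoctahedronOpp e.1 e.2,
    by decide +kernel, by decide +kernel⟩
  opp_match := by decide +kernel

/-- Mutetrahedron `{6, 6}`: truncated tetrahedra, centred at the points of the lattice, whose
vertices are the permutations of `(±1, ±1, ±3)` with an even number of minus signs, and tetrahedra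
(the translates of the one with the vertices `(3, 1, 1)`, `(1, 3, 1)`, `(1, 1, 3)`, `(3, 3, 3)`) meet
along triangles. The faces are the hexagons of the truncated tetrahedra. -/
def mutetrahedronFace : Fin 4 → Fin 6 → ℤ × ℤ × ℤ :=
  ![![(3, -1, -1), (1, -1, -3), (-1, 1, -3), (-1, 3, -1), (1, 3, 1), (3, 1, 1)],
    ![(3, -1, -1), (3, 1, 1), (1, 1, 3), (-1, -1, 3), (-1, -3, 1), (1, -3, -1)],
    ![(-3, -1, 1), (-1, -1, 3), (1, 1, 3), (1, 3, 1), (-1, 3, -1), (-3, 1, -1)],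
    ![(-3, -1, 1), (-3, 1, -1), (-1, 1, -3), (1, -1, -3), (1, -3, -1), (-1, -3, 1)]]

/-- The gluing of the sides of Mutetrahedron: side `j` of face `i` is glued to the listed side. -/
def mutetrahedronOpp : Fin 4 → Fin 6 → Fin 4 × Fin 6 :=
  ![![(2, 0), (3, 2), (1, 3), (2, 3), (3, 5), (1, 0)],
    ![(0, 5), (3, 1), (2, 1), (0, 2), (3, 4), (2, 4)],
    ![(0, 0), (1, 2), (3, 3), (0, 3), (1, 5), (3, 0)],
    ![(2, 5), (1, 1), (0, 1), (2, 2), (1, 4), (0, 4)]]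

/-- Mutetrahedron. -/
def mutetrahedron : PeriodicSurface 4 6 where
  face := mutetrahedronFace
  Λ := fccLattice 4
  opp := ⟨fun e => mutetrahedronOpp e.1 e.2, fun e => mutetrahedronOpp e.1 e.2,
    by decide +kernel, by decide +kernel⟩
  opp_match := by decide +kernel

/-- Octa-4 `{3, 8}`: regular octahedra with the vertices `±3 eᵢ` around the centres `0` and
`(4, 4, 4)`, modulo the lattice, are joined along four of their faces by triangular
antiprisms (regular octahedra with the centres `2 (1, 1, 1)`, `2 (1, -1, -1)`, `2 (-1, 1, -1)`,
`2 (-1, -1, 1)`). The faces are the remaining faces of the octahedra and the lateral faces of the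
antiprisms. -/
def octa4Face : Fin 32 → Fin 3 → ℤ × ℤ × ℤ :=
  ![![(7, 4, 4), (4, 7, 4), (4, 4, 7)],
    ![(3, 0, 0), (0, 3, 0), (4, 4, 1)],
    ![(3, 0, 0), (4, 1, 4), (0, 0, 3)],
    ![(3, 0, 0), (4, 4, 1), (4, 1, 4)],
    ![(1, 4, 4), (0, 3, 0), (0, 0, 3)],
    ![(1, 4, 4), (4, 4, 1), (0, 3, 0)],
    ![(1, 4, 4), (0, 0, 3), (4, 1, 4)],
    ![(3, 0, 0), (0, 0, -3), (0, 3, 0)],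
    ![(3, 0, 0), (0, 0, 3), (0, -3, 0)],
    ![(7, 4, 4), (4, 1, 4), (4, 4, 1)],
    ![(3, 0, 0), (0, -3, 0), (4, -4, -1)],
    ![(3, 0, 0), (4, -1, -4), (0, 0, -3)],
    ![(3, 0, 0), (4, -4, -1), (4, -1, -4)],
    ![(1, -4, -4), (0, -3, 0), (0, 0, -3)],
    ![(1, -4, -4), (4, -4, -1), (0, -3, 0)],
    ![(1, -4, -4), (0, 0, -3), (4, -1, -4)],
    ![(-3, 0, 0), (0, 0, 3), (0, 3, 0)],
    ![(1, 4, 4), (4, 7, 4), (4, 4, 1)],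
    ![(-3, 0, 0), (0, 3, 0), (-4, 4, -1)],
    ![(-3, 0, 0), (-4, 1, -4), (0, 0, -3)],
    ![(-3, 0, 0), (-4, 4, -1), (-4, 1, -4)],
    ![(-1, 4, -4), (0, 3, 0), (0, 0, -3)],
    ![(-1, 4, -4), (-4, 4, -1), (0, 3, 0)],
    ![(-1, 4, -4), (0, 0, -3), (-4, 1, -4)],
    ![(1, 4, 4), (4, 1, 4), (4, 4, 7)],
    ![(-3, 0, 0), (0, -3, 0), (-4, -4, 1)],
    ![(-3, 0, 0), (-4, -1, 4), (0, 0, 3)],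
    ![(-3, 0, 0), (-4, -4, 1), (-4, -1, 4)],
    ![(-1, -4, 4), (0, -3, 0), (0, 0, 3)],
    ![(-1, -4, 4), (-4, -4, 1), (0, -3, 0)],
    ![(-1, -4, 4), (0, 0, 3), (-4, -1, 4)],
    ![(-3, 0, 0), (0, 0, -3), (0, -3, 0)]]

/-- The gluing of the sides of Octa-4: side `j` of face `i` is glued to the listed side. -/
def octa4Opp : Fin 32 → Fin 3 → Fin 32 × Fin 3 :=
  ![![(30, 2), (12, 1), (22, 0)],
    ![(7, 2), (5, 1), (3, 0)],
    ![(3, 2), (6, 1), (8, 0)],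
    ![(1, 2), (9, 1), (2, 0)],
    ![(5, 2), (16, 1), (6, 0)],
    ![(17, 2), (1, 1), (4, 0)],
    ![(4, 2), (2, 1), (24, 0)],
    ![(11, 2), (21, 1), (1, 0)],
    ![(2, 2), (28, 1), (10, 0)],
    ![(23, 2), (3, 1), (29, 0)],
    ![(8, 2), (14, 1), (12, 0)],
    ![(12, 2), (15, 1), (7, 0)],
    ![(10, 2), (0, 1), (11, 0)],
    ![(14, 2), (31, 1), (15, 0)],
    ![(24, 2), (10, 1), (13, 0)],
    ![(13, 2), (11, 1), (17, 0)],
    ![(26, 2), (4, 1), (18, 0)],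
    ![(15, 2), (27, 1), (5, 0)],
    ![(16, 2), (22, 1), (20, 0)],
    ![(20, 2), (23, 1), (31, 0)],
    ![(18, 2), (24, 1), (19, 0)],
    ![(22, 2), (7, 1), (23, 0)],
    ![(0, 2), (18, 1), (21, 0)],
    ![(21, 2), (19, 1), (9, 0)],
    ![(6, 2), (20, 1), (14, 0)],
    ![(31, 2), (29, 1), (27, 0)],
    ![(27, 2), (30, 1), (16, 0)],
    ![(25, 2), (17, 1), (26, 0)],
    ![(29, 2), (8, 1), (30, 0)],
    ![(9, 2), (25, 1), (28, 0)],
    ![(28, 2), (26, 1), (0, 0)],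
    ![(19, 2), (13, 1), (25, 0)]]

/-- Octa-4. -/
def octa4 : PeriodicSurface 32 3 where
  face := octa4Face
  Λ := fccLattice 8
  opp := ⟨fun e => octa4Opp e.1 e.2, fun e => octa4Opp e.1 e.2,
    by decide +kernel, by decide +kernel⟩
  opp_match := by decide +kernel

/-- Truncated Octa-8 `{4, 5}`: truncated octahedra, centred at the points of the lattice, with the
vertices `(0, ±1, ±2)` and their permutations, are joined along their hexagons by hexagonal
prisms. The faces are the squares of the truncated octahedra and the lateral faces of the prisms.
(The height of the prisms is scaled here so that all vertices are integral; this does not change how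
the faces are glued.) -/
def truncatedOcta8Face : Fin 30 → Fin 4 → ℤ × ℤ × ℤ :=
  ![![(2, 1, 0), (1, 2, 0), (2, 3, 1), (3, 2, 1)],
    ![(1, 2, 0), (0, 2, 1), (1, 3, 2), (2, 3, 1)],
    ![(0, 2, 1), (0, 1, 2), (1, 2, 3), (1, 3, 2)],
    ![(0, 1, 2), (1, 0, 2), (2, 1, 3), (1, 2, 3)],
    ![(1, 0, 2), (2, 0, 1), (3, 1, 2), (2, 1, 3)],
    ![(2, 0, 1), (2, 1, 0), (3, 2, 1), (3, 1, 2)],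
    ![(2, 1, 0), (2, 0, -1), (3, 1, -2), (3, 2, -1)],
    ![(2, 0, -1), (1, 0, -2), (2, 1, -3), (3, 1, -2)],
    ![(1, 0, -2), (0, 1, -2), (1, 2, -3), (2, 1, -3)],
    ![(0, 1, -2), (0, 2, -1), (1, 3, -2), (1, 2, -3)],
    ![(0, 2, -1), (1, 2, 0), (2, 3, -1), (1, 3, -2)],
    ![(1, 2, 0), (2, 1, 0), (3, 2, -1), (2, 3, -1)],
    ![(0, -2, 1), (1, -2, 0), (2, -3, 1), (1, -3, 2)],
    ![(1, -2, 0), (2, -1, 0), (3, -2, 1), (2, -3, 1)],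
    ![(2, -1, 0), (2, 0, 1), (3, -1, 2), (3, -2, 1)],
    ![(2, 0, 1), (1, 0, 2), (2, -1, 3), (3, -1, 2)],
    ![(1, 0, 2), (0, -1, 2), (1, -2, 3), (2, -1, 3)],
    ![(0, -1, 2), (0, -2, 1), (1, -3, 2), (1, -2, 3)],
    ![(0, -2, -1), (0, -1, -2), (1, -2, -3), (1, -3, -2)],
    ![(0, -1, -2), (1, 0, -2), (2, -1, -3), (1, -2, -3)],
    ![(1, 0, -2), (2, 0, -1), (3, -1, -2), (2, -1, -3)],
    ![(2, 0, -1), (2, -1, 0), (3, -2, -1), (3, -1, -2)],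
    ![(2, -1, 0), (1, -2, 0), (2, -3, -1), (3, -2, -1)],
    ![(1, -2, 0), (0, -2, -1), (1, -3, -2), (2, -3, -1)],
    ![(2, 1, 0), (2, 0, 1), (2, -1, 0), (2, 0, -1)],
    ![(-2, -1, 0), (-2, 0, 1), (-2, 1, 0), (-2, 0, -1)],
    ![(0, 2, 1), (1, 2, 0), (0, 2, -1), (-1, 2, 0)],
    ![(1, -2, 0), (0, -2, 1), (-1, -2, 0), (0, -2, -1)],
    ![(0, 1, 2), (-1, 0, 2), (0, -1, 2), (1, 0, 2)],
    ![(0, -1, -2), (-1, 0, -2), (0, 1, -2), (1, 0, -2)]]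

/-- The gluing of the sides of Truncated Octa-8: side `j` of face `i` is glued to the listed side. -/
def truncatedOcta8Opp : Fin 30 → Fin 4 → Fin 30 × Fin 4 :=
  ![![(11, 0), (1, 3), (29, 0), (5, 1)],
    ![(26, 0), (2, 3), (12, 2), (0, 1)],
    ![(21, 2), (3, 3), (25, 3), (1, 1)],
    ![(28, 3), (4, 3), (8, 2), (2, 1)],
    ![(15, 0), (5, 3), (27, 2), (3, 1)],
    ![(24, 0), (0, 3), (18, 0), (4, 1)],
    ![(24, 3), (7, 3), (17, 0), (11, 1)],
    ![(20, 0), (8, 3), (27, 1), (6, 1)],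
    ![(29, 2), (9, 3), (3, 2), (7, 1)],
    ![(14, 2), (10, 3), (25, 0), (8, 1)],
    ![(26, 1), (11, 3), (23, 2), (9, 1)],
    ![(0, 0), (6, 3), (28, 1), (10, 1)],
    ![(27, 0), (13, 3), (1, 2), (17, 1)],
    ![(22, 0), (14, 3), (29, 1), (12, 1)],
    ![(24, 1), (15, 3), (9, 0), (13, 1)],
    ![(4, 0), (16, 3), (26, 2), (14, 1)],
    ![(28, 2), (17, 3), (19, 2), (15, 1)],
    ![(6, 2), (12, 3), (25, 2), (16, 1)],
    ![(5, 2), (19, 3), (25, 1), (23, 1)],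
    ![(29, 3), (20, 3), (16, 2), (18, 1)],
    ![(7, 0), (21, 3), (26, 3), (19, 1)],
    ![(24, 2), (22, 3), (2, 0), (20, 1)],
    ![(13, 0), (23, 3), (28, 0), (21, 1)],
    ![(27, 3), (18, 3), (10, 2), (22, 1)],
    ![(5, 0), (14, 0), (21, 0), (6, 0)],
    ![(9, 2), (18, 2), (17, 2), (2, 2)],
    ![(1, 0), (10, 0), (15, 2), (20, 2)],
    ![(12, 0), (7, 2), (4, 2), (23, 0)],
    ![(22, 2), (11, 2), (16, 0), (3, 0)],
    ![(0, 2), (13, 2), (8, 0), (19, 0)]]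

/-- Truncated Octa-8. -/
def truncatedOcta8 : PeriodicSurface 30 4 where
  face := truncatedOcta8Face
  Λ := bccLattice 3
  opp := ⟨fun e => truncatedOcta8Opp e.1 e.2, fun e => truncatedOcta8Opp e.1 e.2,
    by decide +kernel, by decide +kernel⟩
  opp_match := by decide +kernel

/-! ### The square-tiled translation covers

The translation cover is the component, in the square-tiled unfolding, of the square (or rhombus)
whose lower side is a given dart `d`, placed in direction `0`. -/

/-- The translation cover of a surface tiled by squares. -/
def squareCover {D : Type} (M : DartMap D) (d : D) :=
  (M.unfold 4 4).squares.component (d, 0)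

/-- The translation cover of a surface tiled by equilateral triangles, made square-tiled by means of
rhombi with the angle `π / 3`. -/
def rhombusCover60 {D : Type} (M : DartMap D) (d : D) :=
  (M.unfold 6 3).rhombi60.component (d, 0)

/-- The translation cover of a surface tiled by equilateral triangles, made square-tiled by means of
rhombi with the angle `2 * π / 3`. -/
def rhombusCover120 {D : Type} (M : DartMap D) (d : D) :=
  (M.unfold 6 3).rhombi120.component (d, 0)

/-!
Affine homeomorphisms preserve the corners of cone angle greater than `2π`. If a horizontal and a
vertical side of squares of `O` join two such corners, the images of these sides have integral
holonomy, so the derivative of an affine homeomorphism from `O` has integral entries. As soon as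
there is one such corner, an affine homeomorphism with derivative `1` permutes the squares. Hence
the Veech group of `O` is the stabilizer of `O`, up to relabelling of its squares, under the action
of `SL(2, ℤ)` on square-tiled surfaces. The index is then the size of the orbit of `O`, which is
found by closing `O` up under the generators `S` and `T`; the cusps are the `T`-orbits in it, and
the widths are their sizes.
-/

/-! ### Coordinates on a square-tiled surface -/

lemma unitAddCircle_coe_eq_coe {a b : ℝ} (ha : a ∈ Set.Icc 0 1) (hb : b ∈ Set.Icc 0 1)
    (h : (a : UnitAddCircle) = b) : a = b ∨ (a = 1 ∧ b = 0) ∨ (a = 0 ∧ b = 1) := by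
  rw [← sub_eq_zero, ← AddCircle.coe_sub, AddCircle.coe_eq_zero_iff] at h
  obtain ⟨n, hn⟩ := h
  rw [zsmul_eq_mul, mul_one] at hn
  have h_le : n ≤ 1 := by exact_mod_cast (by linarith [ha.2, hb.1] : (n : ℝ) ≤ 1)
  have h_ge : -1 ≤ n := by exact_mod_cast (by linarith [ha.1, hb.2] : (-1 : ℝ) ≤ n)
  obtain ⟨ha₀, ha₁⟩ := ha
  obtain ⟨hb₀, hb₁⟩ := hb
  interval_cases n <;> push_cast at hn <;> grind

lemma unitAddCircle_coe_eq_coe_iff_of_mem_Ioo {a b : ℝ} (ha : a ∈ Set.Icc 0 1)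
    (hb : b ∈ Set.Ioo 0 1) : (a : UnitAddCircle) = b ↔ a = b := by
  refine ⟨fun h => ?_, congrArg _⟩
  have := unitAddCircle_coe_eq_coe ha ⟨hb.1.le, hb.2.le⟩ h
  grind

lemma unitAddCircle_coe_eq_zero_iff {a : ℝ} (ha : a ∈ Set.Icc 0 1) :
    (a : UnitAddCircle) = 0 ↔ a = 0 ∨ a = 1 := by
  refine ⟨fun h => ?_, ?_⟩
  · have := unitAddCircle_coe_eq_coe ha (b := 0) (by simp) h
    grind
  · rintro (rfl | rfl)
    · exact AddCircle.coe_zero 1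
    · exact AddCircle.coe_period 1

namespace SquareTiled

open Filter Topology

variable {ι : Type}

instance : PreconnectedSpace Square :=
  Subtype.preconnectedSpace (convex_Icc (0 : Fin 2 → ℝ) 1).isPreconnected

lemma Square.mem_Icc (p : Square) (l : Fin 2) : p.1 l ∈ Set.Icc (0 : ℝ) 1 :=
  ⟨p.2.1 l, p.2.2 l⟩

lemma Square.continuous_apply (l : Fin 2) : Continuous fun p : Square => p.1 l :=
  (_root_.continuous_apply l).comp continuous_subtype_val

/-- The permutation by which a square is left in the `k`-th coordinate direction. -/
def side (O : SquareTiled ι) (k : Fin 2) : Equiv.Perm ι := ![O.h, O.v] k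

section Surface

variable (O : SquareTiled ι)

lemma point_eq_point_side (k : Fin 2) (i : ι) {p q : Square} (hp : p.1 k = 1) (hq : q.1 k = 0)
    (hpq : ∀ l, l ≠ k → p.1 l = q.1 l) : O.point i p = O.point (O.side k i) q := by
  fin_cases k
  · exact Quot.sound (Glue.right i p q hp hq (hpq 1 (by decide)))
  · exact Quot.sound (Glue.top i p q hp hq (hpq 0 (by decide)))

variable {O} in
lemma Glue.exists_side {x y : Σ _ : ι, Square} (h : O.Glue x y) :
    ∃ k : Fin 2, y.1 = O.side k x.1 ∧ x.2.1 k = 1 ∧ y.2.1 k = 0 ∧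
      ∀ l, l ≠ k → x.2.1 l = y.2.1 l := by
  cases h with
  | right i p q hp hq hpq => exact ⟨0, rfl, hp, hq, by simpa [Fin.forall_fin_two] using hpq⟩
  | top i p q hp hq hpq => exact ⟨1, rfl, hp, hq, by simpa [Fin.forall_fin_two] using hpq⟩

lemma exists_point (x : O.Surface) : ∃ i p, x = O.point i p := by
  obtain ⟨⟨i, p⟩, rfl⟩ := Quot.exists_rep x
  exact ⟨i, p, rfl⟩

lemma continuous_point (i : ι) : Continuous (O.point i) :=
  continuous_quot_mk.comp continuous_sigmaMk

lemma isOpen_iff_point (U : Set O.Surface) : IsOpen U ↔ ∀ i, IsOpen (O.point i ⁻¹' U) := by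
  rw [← isQuotientMap_quot_mk.isOpen_preimage, isOpen_sigma_iff]
  rfl

lemma continuous_iff_point {X : Type} [TopologicalSpace X] (f : O.Surface → X) :
    Continuous f ↔ ∀ i, Continuous fun p => f (O.point i p) := by
  rw [isQuotientMap_quot_mk.continuous_iff, continuous_sigma_iff]
  rfl

end Surface

/-- The projection of the plane onto the torus `ℝ² / ℤ²`. -/
def toTorus : (Fin 2 → ℝ) →+ (Fin 2 → UnitAddCircle) :=
  (QuotientAddGroup.mk' _).compLeft (Fin 2)

lemma toTorus_apply (w : Fin 2 → ℝ) (l : Fin 2) : toTorus w l = (w l : UnitAddCircle) := rfl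

section Coordinates

variable (O : SquareTiled ι)

/-- The map of a square-tiled surface to the torus `ℝ² / ℤ²` that is the identity on every square.
It is a local homeomorphism at all points but the corners of the squares. -/
def coord : O.Surface → Fin 2 → UnitAddCircle :=
  Quot.lift (fun x => toTorus x.2.1) fun x y h => by
    obtain ⟨k, -, hx, hy, hxy⟩ := h.exists_side
    funext l
    rcases eq_or_ne l k with rfl | hl
    · simp only [toTorus_apply, hx, hy, AddCircle.coe_zero]
      exact AddCircle.coe_period 1
    · simp only [toTorus_apply, hxy l hl]

lemma coord_point (i : ι) (p : Square) : O.coord (O.point i p) = toTorus p.1 := rfl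

/-- The representative in `[0, 1)²` of the position relative to `b`. Off the lines through `b` it
is a primitive of the one-form of the surface. -/
noncomputable def coordFrom (b : Fin 2 → ℝ) : O.Surface → Fin 2 → ℝ :=
  Quot.lift (fun x l => Int.fract (x.2.1 l - b l)) fun x y h => by
    obtain ⟨k, -, hx, hy, hxy⟩ := h.exists_side
    funext l
    rcases eq_or_ne l k with rfl | hl
    · exact Int.fract_eq_fract.2 ⟨1, by simp [hx, hy]⟩
    · rw [hxy l hl]

lemma coordFrom_point (b : Fin 2 → ℝ) (i : ι) (p : Square) (l : Fin 2) :
    O.coordFrom b (O.point i p) l = Int.fract (p.1 l - b l) := rfl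

lemma toTorus_coordFrom (b : Fin 2 → ℝ) (x : O.Surface) :
    toTorus (O.coordFrom b x) = O.coord x - toTorus b := by
  obtain ⟨i, p, rfl⟩ := O.exists_point x
  rw [coord_point, ← map_sub]
  funext l
  rw [toTorus_apply, toTorus_apply, Pi.sub_apply, coordFrom_point, Int.fract, AddCircle.coe_sub,
    sub_eq_self, AddCircle.coe_eq_zero_iff]
  exact ⟨⌊p.1 l - b l⌋, by simp⟩

/-- The surface cut along the horizontal and the vertical lines through `b` modulo `ℤ²`. -/
def cutSurface (b : Fin 2 → ℝ) : Set O.Surface := {x | ∀ l, O.coord x l ≠ toTorus b l}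

lemma mem_cutSurface_point (b : Fin 2 → ℝ) (i : ι) (p : Square) :
    O.point i p ∈ O.cutSurface b ↔ ∀ l, Int.fract (p.1 l - b l) ≠ 0 := by
  refine forall_congr' fun l => not_congr ?_
  rw [coord_point, ← sub_eq_zero, ← Pi.sub_apply, ← map_sub, toTorus_apply,
    AddCircle.coe_eq_zero_iff, Int.fract_eq_zero_iff]
  simp [Set.mem_range]

lemma isOpen_cutSurface (b : Fin 2 → ℝ) : IsOpen (O.cutSurface b) := by
  rw [isOpen_iff_point]
  intro i
  have h_preimage : O.point i ⁻¹' O.cutSurface b =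
      ⋂ l, (fun p : Square => p.1 l - b l) ⁻¹' (Set.range ((↑) : ℤ → ℝ))ᶜ := by
    ext p
    simp only [Set.mem_preimage, mem_cutSurface_point, ne_eq, Int.fract_eq_zero_iff,
      Set.mem_iInter, Set.mem_compl_iff]
  rw [h_preimage]
  exact isOpen_iInter_of_finite fun l => Int.isClosedEmbedding_coe_real.isClosed_range.isOpen_compl
    |>.preimage ((Square.continuous_apply l).sub continuous_const)

lemma eventually_floor_eq {r : ℝ} (hr : Int.fract r ≠ 0) : ∀ᶠ s in 𝓝 r, ⌊s⌋ = ⌊r⌋ := by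
  have h_lt : (⌊r⌋ : ℝ) < r :=
    (Int.floor_le r).lt_of_ne fun h => hr (by rw [Int.fract, h, sub_self])
  filter_upwards [Ioo_mem_nhds h_lt (Int.lt_floor_add_one r)] with s hs
  exact Int.floor_eq_iff.2 ⟨hs.1.le, hs.2⟩

lemma isPrimitive_coordFrom (b : Fin 2 → ℝ) :
    O.IsPrimitive (O.cutSurface b) (O.coordFrom b) := by
  intro i p hp
  rw [mem_cutSurface_point] at hp
  have h_floor : ∀ l, ∀ᶠ q : Square in 𝓝 p, ⌊q.1 l - b l⌋ = ⌊p.1 l - b l⌋ := fun l =>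
    ((Square.continuous_apply l).sub continuous_const).continuousAt.eventually
      (eventually_floor_eq (hp l))
  filter_upwards [eventually_all.2 h_floor] with q hq
  funext l
  simp only [Pi.sub_apply, coordFrom_point, Int.fract, hq l]
  ring

variable {O} in
lemma IsPrimitive.mono {U V : Set O.Surface} {φ : O.Surface → Fin 2 → ℝ} (h : O.IsPrimitive V φ)
    (hUV : U ⊆ V) : O.IsPrimitive U φ :=
  fun i p hp => h i p (hUV hp)

end Coordinates

/-! ### Shifted tiles and unique continuation -/

section ShiftedTile

variable (O : SquareTiled ι) (k : Fin 2) (c : Set.Ioo (0 : ℝ) 1)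

open Classical in
/-- The tiling by squares shifted by `c` in the `k`-th coordinate direction: the shifted tile `i`
consists of the points of the square `i` beyond the line where the `k`-th coordinate is `c`, and
of the points of the next square before this line. The sides of the shifted tiles belong to no
shifted tile. The midpoints of the sides of the original squares across the `k`-th direction thus
become interior points, so that tiles can be compared across these sides. -/
noncomputable def shiftedTile : O.Surface → Option ι :=
  Quot.lift (fun x => if ∀ l, l ≠ k → x.2.1 l ∈ Set.Ioo (0 : ℝ) 1 then
      if c < x.2.1 k then some x.1 else if x.2.1 k < c then some ((O.side k).symm x.1) else none
    else none) fun x y h => by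
    obtain ⟨k', hi, hx, hy, hxy⟩ := h.exists_side
    obtain ⟨hc₀, hc₁⟩ := c.2
    rcases eq_or_ne k k' with rfl | hk
    · have h_strip : (∀ l, l ≠ k → x.2.1 l ∈ Set.Ioo (0 : ℝ) 1) ↔
          ∀ l, l ≠ k → y.2.1 l ∈ Set.Ioo (0 : ℝ) 1 :=
        forall₂_congr fun l hl => by rw [hxy l hl]
      simp only [h_strip, hx, hy, hi, hc₀, hc₁, hc₀.not_gt, if_true, if_false,
        Equiv.symm_apply_apply]
    · rw [if_neg fun h => by simpa [hx] using h k' hk.symm,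
        if_neg fun h => by simpa [hy] using h k' hk.symm]

lemma shiftedTile_point_eq_some_iff (i j : ι) (p : Square) :
    O.shiftedTile k c (O.point i p) = some j ↔ (∀ l, l ≠ k → p.1 l ∈ Set.Ioo (0 : ℝ) 1) ∧
      (c < p.1 k ∧ i = j ∨ p.1 k < c ∧ i = O.side k j) := by
  change (if _ then _ else _) = _ ↔ _
  split_ifs with h_strip h_gt h_lt
  · rw [and_iff_right h_strip]
    simp [h_gt, h_gt.not_gt]
  · rw [and_iff_right h_strip]
    simp [h_gt, h_lt, Equiv.symm_apply_eq]
  · simp [h_gt, h_lt]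
  · simp only [h_strip, false_and]

lemma isOpen_shiftedTile (j : ι) : IsOpen {x | O.shiftedTile k c x = some j} := by
  rw [isOpen_iff_point]
  intro i
  simp only [Set.preimage_ofPred_eq, shiftedTile_point_eq_some_iff, Set.ofPred_and, Set.ofPred_or,
    Set.ofPred_forall]
  exact (isOpen_iInter_of_finite fun l => isOpen_iInter_of_finite fun _ =>
    isOpen_Ioo.preimage (Square.continuous_apply l)).inter
    (((isOpen_lt continuous_const (Square.continuous_apply k)).inter isOpen_const).union
      ((isOpen_lt (Square.continuous_apply k) continuous_const).inter isOpen_const))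

lemma exists_shiftedTile_eq_some_iff (x : O.Surface) :
    (∃ j, O.shiftedTile k c x = some j) ↔ x ∈ O.cutSurface (Pi.single k c) := by
  obtain ⟨i, p, rfl⟩ := O.exists_point x
  have h_line : O.coord (O.point i p) k = toTorus (Pi.single k c.1) k ↔ p.1 k = c := by
    rw [coord_point, toTorus_apply, toTorus_apply, Pi.single_eq_same,
      unitAddCircle_coe_eq_coe_iff_of_mem_Ioo (p.mem_Icc k) c.2]
  have h_side : ∀ l, l ≠ k →
      (O.coord (O.point i p) l ≠ toTorus (Pi.single k c.1) l ↔ p.1 l ∈ Set.Ioo (0 : ℝ) 1) := by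
    intro l hl
    have hp := p.mem_Icc l
    rw [coord_point, toTorus_apply, toTorus_apply, Pi.single_eq_of_ne hl, AddCircle.coe_zero,
      ne_eq, unitAddCircle_coe_eq_zero_iff hp]
    grind
  simp only [shiftedTile_point_eq_some_iff]
  constructor
  · rintro ⟨j, h_strip, hj⟩ l
    rcases eq_or_ne l k with rfl | hl
    · rw [ne_eq, h_line]
      grind
    · exact (h_side l hl).2 (h_strip l hl)
  · intro hx
    have h_strip : ∀ l, l ≠ k → p.1 l ∈ Set.Ioo (0 : ℝ) 1 := fun l hl => (h_side l hl).1 (hx l)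
    rcases lt_or_gt_of_ne (mt h_line.2 (hx k)) with h | h
    · exact ⟨(O.side k).symm i, h_strip, Or.inr ⟨h, by simp⟩⟩
    · exact ⟨i, h_strip, Or.inl ⟨h, rfl⟩⟩

variable {O k c} in
lemma eq_of_shiftedTile_eq {x y : O.Surface} {j : ι} (hx : O.shiftedTile k c x = some j)
    (hy : O.shiftedTile k c y = some j) (hxy : O.coord x = O.coord y) : x = y := by
  obtain ⟨i, p, rfl⟩ := O.exists_point x
  obtain ⟨i', q, rfl⟩ := O.exists_point y
  rw [shiftedTile_point_eq_some_iff] at hx hy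
  have h_coe : ∀ l, p.1 l = q.1 l ∨ (p.1 l = 1 ∧ q.1 l = 0) ∨ (p.1 l = 0 ∧ q.1 l = 1) :=
    fun l => unitAddCircle_coe_eq_coe (p.mem_Icc l) (q.mem_Icc l) (congrFun hxy l)
  have h_ne : ∀ l, l ≠ k → p.1 l = q.1 l := by grind
  rcases h_coe k with hk | ⟨hp, hq⟩ | ⟨hp, hq⟩
  · obtain rfl : i = i' := by grind
    have hpq : p = q := Subtype.ext (funext fun l => by grind)
    rw [hpq]
  · obtain ⟨rfl, rfl⟩ : i = j ∧ i' = O.side k j := by grind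
    exact O.point_eq_point_side k i hp hq h_ne
  · obtain ⟨rfl, rfl⟩ : i' = j ∧ i = O.side k j := by grind
    exact (O.point_eq_point_side k i' hq hp fun l hl => (h_ne l hl).symm).symm

end ShiftedTile

lemma exists_cut_of_ne_zero {t : Fin 2 → UnitAddCircle} (ht : t ≠ 0) :
    ∃ (k : Fin 2) (c : Set.Ioo (0 : ℝ) 1), ∀ l, t l ≠ toTorus (Pi.single k c.1) l := by
  obtain ⟨l₀, hl₀⟩ := Function.ne_iff.1 ht
  obtain ⟨k, hk⟩ : ∃ k : Fin 2, ∀ l, l ≠ k → l = l₀ := ⟨1 - l₀, by omega⟩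
  obtain ⟨c, hc⟩ : ∃ c : Set.Ioo (0 : ℝ) 1, t k ≠ (c.1 : UnitAddCircle) := by
    by_contra! h
    have h_eq := (h ⟨1 / 2, by norm_num⟩).symm.trans (h ⟨1 / 3, by norm_num⟩)
    rw [unitAddCircle_coe_eq_coe_iff_of_mem_Ioo (by norm_num) (by norm_num)] at h_eq
    norm_num at h_eq
  refine ⟨k, c, fun l => ?_⟩
  rw [toTorus_apply]
  rcases eq_or_ne l k with rfl | hl
  · rwa [Pi.single_eq_same]
  · rwa [Pi.single_eq_of_ne hl, hk l hl, AddCircle.coe_zero]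

/-- Away from the corners the map to the torus is a local homeomorphism, and the tiles shifted in a
suitable direction are a family of disjoint sheets: hence the uniqueness of lifts. -/
lemma eq_of_coord_eq {O : SquareTiled ι} {X : Type} [TopologicalSpace X] [PreconnectedSpace X]
    {g g' : X → O.Surface} (hg : Continuous g) (hg' : Continuous g')
    (h_coord : ∀ x, O.coord (g x) = O.coord (g' x)) (h_ne : ∀ x, O.coord (g x) ≠ 0) {x₀ : X}
    (h₀ : g x₀ = g' x₀) (x : X) : g x = g' x := by
  have h_loc : IsLocallyConstant fun x => g x = g' x := by
    rw [IsLocallyConstant.iff_eventually_eq]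
    intro x
    obtain ⟨k, c, hx⟩ := exists_cut_of_ne_zero (h_ne x)
    obtain ⟨j, hj⟩ := (O.exists_shiftedTile_eq_some_iff k c (g x)).2 hx
    obtain ⟨j', hj'⟩ := (O.exists_shiftedTile_eq_some_iff k c (g' x)).2 fun l => by
      rw [← h_coord]
      exact hx l
    have h_iff : ∀ y, O.shiftedTile k c (g y) = some j → O.shiftedTile k c (g' y) = some j' →
        (g y = g' y ↔ j = j') := fun y hy hy' =>
      ⟨fun h => Option.some_injective _ (hy.symm.trans (h ▸ hy')), fun h =>
        eq_of_shiftedTile_eq hy (h ▸ hy') (h_coord y)⟩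
    filter_upwards [hg.continuousAt ((O.isOpen_shiftedTile k c j).mem_nhds hj),
      hg'.continuousAt ((O.isOpen_shiftedTile k c j').mem_nhds hj')] with y hy hy'
    exact propext ((h_iff y hy hy').trans (h_iff x hj hj').symm)
  exact (h_loc.apply_eq_of_preconnectedSpace x x₀).mpr h₀

lemma tile_eq_of_point_eq {O : SquareTiled ι} {i j : ι} {p : Square}
    (hp : ∀ l, p.1 l ∈ Set.Ioo (0 : ℝ) 1) (h : O.point i p = O.point j p) : i = j := by
  have hc : p.1 0 / 2 ∈ Set.Ioo (0 : ℝ) 1 := ⟨by linarith [(hp 0).1], by linarith [(hp 0).2]⟩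
  have h_tile : ∀ i, O.shiftedTile 0 ⟨_, hc⟩ (O.point i p) = some i := fun i =>
    (O.shiftedTile_point_eq_some_iff _ _ _ _ _).2
      ⟨fun l _ => hp l, Or.inl ⟨half_lt_self (hp 0).1, rfl⟩⟩
  exact Option.some_injective _ ((h_tile i).symm.trans (h ▸ h_tile j))

/-! ### Regular and singular points -/

/-- A point is regular if the surface has a translation chart near it. -/
def IsRegularPoint (O : SquareTiled ι) (x : O.Surface) : Prop :=
  ∃ U φ, IsOpen U ∧ x ∈ U ∧ O.IsPrimitive U φ ∧ Set.InjOn φ U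

lemma isRegularPoint_of_coord_ne_zero {O : SquareTiled ι} {x : O.Surface} (hx : O.coord x ≠ 0) :
    O.IsRegularPoint x := by
  obtain ⟨k, c, hx⟩ := exists_cut_of_ne_zero hx
  obtain ⟨j, hj⟩ := (O.exists_shiftedTile_eq_some_iff k c x).2 hx
  refine ⟨{x | O.shiftedTile k c x = some j}, O.coordFrom (Pi.single k c.1),
    O.isOpen_shiftedTile k c j, hj, (O.isPrimitive_coordFrom _).mono fun y hy => ?_,
    fun y hy z hz hyz => eq_of_shiftedTile_eq hy hz ?_⟩
  · exact (O.exists_shiftedTile_eq_some_iff k c y).1 ⟨j, hy⟩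
  · have h := congrArg toTorus hyz
    rwa [toTorus_coordFrom, toTorus_coordFrom, sub_left_inj] at h

/-- The upper right corner of a square. -/
def corner : Square := ⟨1, zero_le_one, le_rfl⟩

/-- The lower left corner of a square. -/
def origin : Square := ⟨0, le_rfl, zero_le_one⟩

/-- The corner of a square that precedes the upper right corner in the `k`-th direction. -/
def prevCorner (k : Fin 2) : Square :=
  ⟨1 - Pi.single k 1, by constructor <;> intro j <;> by_cases h : j = k <;> simp [h]⟩

/-- The upper right corner of the square `i` is a singularity: going around it, one does not close
up after four squares. -/
def IsSingularCorner (O : SquareTiled ι) (i : ι) : Prop := O.h (O.v i) ≠ O.v (O.h i)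

lemma coord_corner (O : SquareTiled ι) (i : ι) : O.coord (O.point i corner) = 0 :=
  funext fun _ => AddCircle.coe_period 1

lemma point_corner (O : SquareTiled ι) (k : Fin 2) (i : ι) :
    O.point i corner = O.point (O.side k i) (prevCorner k) :=
  O.point_eq_point_side k i rfl (by simp [prevCorner])
    (fun l hl => by simp [prevCorner, corner, hl])

lemma point_corner_eq_point_origin (O : SquareTiled ι) {k l : Fin 2} (hkl : l ≠ k) (i : ι) :
    O.point i corner = O.point (O.side l (O.side k i)) origin :=
  (O.point_corner k i).trans <| O.point_eq_point_side l _ (by simp [prevCorner, hkl]) rfl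
    fun m hm => by
      obtain rfl : m = k := by omega
      simp [prevCorner, origin]

/-- At a singular corner both squares beyond it are seen in the same direction, so that a primitive
takes the same values on their diagonals. -/
lemma IsSingularCorner.not_isRegularPoint {O : SquareTiled ι} {i : ι} (hi : O.IsSingularCorner i) :
    ¬ O.IsRegularPoint (O.point i corner) := by
  rintro ⟨U, φ, hU, hx, hφ, h_inj⟩
  have h_near : ∀ j, O.point i corner = O.point j origin →
      ∀ᶠ q in 𝓝 origin, O.point j q ∈ U ∧ φ (O.point j q) = φ (O.point i corner) + q.1 := by
    intro j hj
    rw [hj] at hx ⊢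
    filter_upwards [hφ j origin hx, (O.continuous_point j).continuousAt (hU.mem_nhds hx)]
      with q hq hqU
    refine ⟨hqU, ?_⟩
    rw [← sub_eq_iff_eq_add', hq]
    simp [origin]
  let diagonal : unitInterval → Square := fun ε => ⟨fun _ => ε, fun _ => ε.2.1, fun _ => ε.2.2⟩
  have h_diagonal : Tendsto diagonal (𝓝[≠] 0) (𝓝 origin) :=
    ((by fun_prop : Continuous diagonal).tendsto' 0 origin rfl).mono_left nhdsWithin_le_nhds
  have h_lt_one : ∀ᶠ ε : unitInterval in 𝓝[≠] 0, (ε : ℝ) < 1 :=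
    nhdsWithin_le_nhds <|
      (isOpen_lt continuous_subtype_val continuous_const).mem_nhds (by simp)
  obtain ⟨ε, ⟨⟨hvh, hvh'⟩, ⟨hhv, hhv'⟩⟩, hε₁, hε₀⟩ :=
    ((h_diagonal.eventually ((h_near _ (O.point_corner_eq_point_origin one_ne_zero i)).and
      (h_near _ (O.point_corner_eq_point_origin zero_ne_one i)))).and
      (h_lt_one.and self_mem_nhdsWithin)).exists
  have hε_pos : (0 : ℝ) < ε := ε.2.1.lt_of_ne fun h => hε₀ (Subtype.ext h.symm)
  exact hi (tile_eq_of_point_eq (fun _ => ⟨hε_pos, hε₁⟩)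
    (h_inj hvh hhv (hvh'.trans hhv'.symm))).symm

variable {κ μ : Type}

/-! ### Affine homeomorphisms between square-tiled surfaces -/

/-- The homeomorphism `f` between square-tiled surfaces is affine with derivative `A`, in the sense
of `IsAffine`. -/
def IsAffineBetween (O : SquareTiled ι) (O' : SquareTiled κ) (A : SL(2, ℝ))
    (f : O.Surface ≃ₜ O'.Surface) : Prop :=
  ∀ (U : Set O.Surface) (φ : O'.Surface → (Fin 2 → ℝ)), IsOpen U →
    (O'.IsPrimitive (f '' U) φ ↔ O.IsPrimitive U fun x => A⁻¹ • φ (f x))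

/-- There is an affine homeomorphism with derivative `A` from `O` to `O'`, that is, `O'` is
isomorphic to `A • O` as a translation surface. -/
def AffinelyEquivalent (O : SquareTiled ι) (O' : SquareTiled κ) (A : SL(2, ℝ)) : Prop :=
  ∃ f : O.Surface ≃ₜ O'.Surface, IsAffineBetween O O' A f

lemma mem_veechGroup_iff (O : SquareTiled ι) (A : SL(2, ℝ)) :
    A ∈ O.veechGroup ↔ AffinelyEquivalent O O A := Iff.rfl

lemma AffinelyEquivalent.trans {O : SquareTiled ι} {O' : SquareTiled κ} {O'' : SquareTiled μ}
    {A B : SL(2, ℝ)} (h : AffinelyEquivalent O O' A) (h' : AffinelyEquivalent O' O'' B) :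
    AffinelyEquivalent O O'' (B * A) := by
  obtain ⟨g, hg⟩ := h
  obtain ⟨f, hf⟩ := h'
  refine ⟨g.trans f, fun U φ hU => ?_⟩
  have h_first := hf (g '' U) φ (g.isOpenMap U hU)
  rw [Set.image_image] at h_first
  simp only [mul_inv_rev, mul_smul]
  exact h_first.trans (hg U (fun x => B⁻¹ • φ (f x)) hU)

lemma AffinelyEquivalent.symm {O : SquareTiled ι} {O' : SquareTiled κ} {A : SL(2, ℝ)}
    (h : AffinelyEquivalent O O' A) : AffinelyEquivalent O' O A⁻¹ := by
  obtain ⟨f, hf⟩ := h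
  refine ⟨f.symm, fun U φ hU => ?_⟩
  have h := hf (f.symm '' U) (fun x => A • φ (f.symm x)) (f.symm.isOpenMap U hU)
  simp only [Set.image_image, Homeomorph.apply_symm_apply, Set.image_id',
    Homeomorph.symm_apply_apply, inv_smul_smul] at h
  simpa only [inv_inv] using h.symm

/-! ### Rigidity of affine homeomorphisms -/

lemma exists_mem_cutSurface {O : SquareTiled ι} (x : O.Surface) : ∃ b, x ∈ O.cutSurface b := by
  refine ⟨O.coordFrom 0 x + fun _ => 1 / 2, fun l h => ?_⟩
  rw [map_add, toTorus_coordFrom, map_zero, sub_zero, Pi.add_apply, left_eq_add, toTorus_apply,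
    unitAddCircle_coe_eq_zero_iff (by norm_num)] at h
  norm_num at h

/-- The upper right corners of the square `i` and of the next square in the `k`-th coordinate
direction are singular for some `i`, so that the side between them is a saddle connection. -/
def HasSingularSide (O : SquareTiled ι) (k : Fin 2) : Prop :=
  ∃ i, O.IsSingularCorner i ∧ O.IsSingularCorner (O.side k i)

/-- Every square can be reached from every other one by crossing sides. -/
def IsConnected (O : SquareTiled ι) : Prop :=
  ∀ s : Set ι, s.Nonempty → (∀ k i, O.side k i ∈ s ↔ i ∈ s) → s = Set.univ

section Rigidity

variable {O : SquareTiled ι} {O' : SquareTiled κ} {A : SL(2, ℝ)} {f : O.Surface ≃ₜ O'.Surface}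

lemma IsAffineBetween.isRegularPoint (hf : IsAffineBetween O O' A f) {x : O.Surface}
    (hx : O'.IsRegularPoint (f x)) : O.IsRegularPoint x := by
  obtain ⟨U, φ, hU, hxU, hφ, h_inj⟩ := hx
  refine ⟨f ⁻¹' U, fun x => A⁻¹ • φ (f x), hU.preimage f.continuous, hxU,
    (hf _ φ (hU.preimage f.continuous)).1 ((f.image_preimage U).symm ▸ hφ),
    fun y hy z hz hyz => f.injective (h_inj hy hz (smul_left_cancel _ hyz))⟩

lemma IsAffineBetween.eventually_coord_eq (hf : IsAffineBetween O O' A f) (i : ι) (p : Square) :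
    ∀ᶠ q : Square in 𝓝 p, O'.coord (f (O.point i q)) =
      O'.coord (f (O.point i p)) + toTorus (A • (q.1 - p.1)) := by
  obtain ⟨b, hb⟩ := exists_mem_cutSurface (f (O.point i p))
  have h_primitive := (hf _ (O'.coordFrom b) ((O'.isOpen_cutSurface b).preimage f.continuous)).1
    ((f.image_preimage _).symm ▸ O'.isPrimitive_coordFrom b)
  filter_upwards [h_primitive i p hb] with q hq
  rw [← hq, smul_sub, smul_inv_smul, smul_inv_smul, map_sub, toTorus_coordFrom, toTorus_coordFrom]
  abel

lemma IsAffineBetween.coord_eq_add (hf : IsAffineBetween O O' A f) (i : ι) (p q : Square) :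
    O'.coord (f (O.point i q)) = O'.coord (f (O.point i p)) + toTorus (A • (q.1 - p.1)) := by
  have h_loc : IsLocallyConstant fun q : Square =>
      O'.coord (f (O.point i q)) - toTorus (A • q.1) := by
    rw [IsLocallyConstant.iff_eventually_eq]
    intro p
    filter_upwards [hf.eventually_coord_eq i p] with q hq
    rw [hq, smul_sub, map_sub]
    abel
  rw [sub_eq_iff_eq_add.1 (h_loc.apply_eq_of_preconnectedSpace q p), smul_sub, map_sub]
  abel

lemma IsAffineBetween.coord_corner (hf : IsAffineBetween O O' A f) {i : ι}
    (hi : O.IsSingularCorner i) : O'.coord (f (O.point i corner)) = 0 := by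
  by_contra h
  exact hi.not_isRegularPoint (hf.isRegularPoint (isRegularPoint_of_coord_ne_zero h))

/-- The image of a side with singular end points has integral holonomy. -/
lemma IsAffineBetween.exists_int (hf : IsAffineBetween O O' A f) {k : Fin 2}
    (hk : O.HasSingularSide k) (l : Fin 2) : ∃ n : ℤ, A.1 l k = n := by
  obtain ⟨i, hi, hi'⟩ := hk
  have h := hf.coord_eq_add (O.side k i) (prevCorner k) corner
  rw [← O.point_corner k i, hf.coord_corner hi, hf.coord_corner hi', zero_add] at h
  have h_column : (A • (corner.1 - (prevCorner k).1)) l = A.1 l k := by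
    simp [prevCorner, corner, Matrix.SpecialLinearGroup.smul_def]
  obtain ⟨n, hn⟩ : ∃ n : ℤ, n • (1 : ℝ) = A.1 l k := by
    rw [← AddCircle.coe_eq_zero_iff, ← h_column, ← toTorus_apply, ← h, Pi.zero_apply]
  exact ⟨n, by simpa using hn.symm⟩

lemma IsAffineBetween.coord_eq (hf : IsAffineBetween O O' 1 f) (hO : O.IsConnected) {i : ι}
    (hi : O.IsSingularCorner i) (x : O.Surface) : O'.coord (f x) = O.coord x := by
  have h_square : ∀ j p q, O'.coord (f (O.point j p)) = O.coord (O.point j p) →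
      O'.coord (f (O.point j q)) = O.coord (O.point j q) := fun j p q hp => by
    rw [hf.coord_eq_add j p q, hp, one_smul, coord_point, coord_point, ← map_add,
      add_sub_cancel]
  have h_univ := hO {j | ∀ p, O'.coord (f (O.point j p)) = O.coord (O.point j p)}
    ⟨i, fun p => h_square i corner p (by rw [hf.coord_corner hi, O.coord_corner])⟩
    fun k j => ⟨fun h q => h_square j corner q (by rw [O.point_corner k j]; exact h _),
      fun h q => h_square _ (prevCorner k) q (by rw [← O.point_corner k j]; exact h _)⟩
  obtain ⟨j, p, rfl⟩ := O.exists_point x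
  exact Set.eq_univ_iff_forall.1 h_univ j p

end Rigidity

/-- A map between the squares of two square-tiled surfaces that respects the gluing. -/
def IsTileMap (O : SquareTiled ι) (O' : SquareTiled κ) (e : ι → κ) : Prop :=
  ∀ k i, e (O.side k i) = O'.side k (e i)

/-- The point of a square with all coordinates equal to `1 / 2` except for the `k`-th, which is `r`.
For fixed `k` these points join the midpoints of two opposite sides. -/
noncomputable def midpoint (k : Fin 2) (r : unitInterval) : Square :=
  ⟨Function.update (fun _ => 1 / 2) k r, by
    constructor <;> intro l <;> by_cases h : l = k <;> simp [h, r.2.1, r.2.2]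
    norm_num⟩

lemma midpoint_self (k : Fin 2) (r : unitInterval) : (midpoint k r).1 k = r := by
  simp [midpoint]

lemma midpoint_of_ne {k l : Fin 2} (h : l ≠ k) (r : unitInterval) :
    (midpoint k r).1 l = 1 / 2 := by
  simp [midpoint, h]

lemma continuous_midpoint (k : Fin 2) : Continuous (midpoint k) :=
  .subtype_mk (continuous_const.update (A := fun _ => ℝ) k continuous_subtype_val) _

lemma coord_midpoint_ne_zero (O : SquareTiled ι) (k : Fin 2) (r : unitInterval) (i : ι) :
    O.coord (O.point i (midpoint k r)) ≠ 0 := by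
  obtain ⟨l, hl⟩ : ∃ l, l ≠ k := exists_ne k
  refine Function.ne_iff.2 ⟨l, ?_⟩
  rw [coord_point, toTorus_apply, midpoint_of_ne hl, Pi.zero_apply, ne_eq,
    unitAddCircle_coe_eq_zero_iff (by norm_num)]
  norm_num

lemma point_midpoint_one (O : SquareTiled ι) (k : Fin 2) (i : ι) :
    O.point i (midpoint k 1) = O.point (O.side k i) (midpoint k 0) :=
  O.point_eq_point_side k i (midpoint_self k 1) (midpoint_self k 0) fun l hl => by
    rw [midpoint_of_ne hl, midpoint_of_ne hl]

lemma point_midpoint_injective (O : SquareTiled ι) (k : Fin 2) :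
    Function.Injective fun i => O.point i (midpoint k 0) := by
  intro i j h
  have h_tile : ∀ i, O.shiftedTile k ⟨1 / 2, by norm_num⟩ (O.point i (midpoint k 0)) =
      some ((O.side k).symm i) := fun i =>
    (O.shiftedTile_point_eq_some_iff _ _ _ _ _).2
      ⟨fun l hl => by rw [midpoint_of_ne hl]; norm_num, Or.inr ⟨by simp [midpoint_self], by simp⟩⟩
  exact (O.side k).symm.injective
    (Option.some_injective _ ((h_tile i).symm.trans ((congrArg _ h).trans (h_tile j))))

lemma midpoint_half (k : Fin 2) : (midpoint k ⟨1 / 2, by norm_num⟩).1 = fun _ => 1 / 2 :=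
  Function.update_eq_self k _

lemma IsAffineBetween.exists_isTileMap {O : SquareTiled ι} {O' : SquareTiled κ}
    {f : O.Surface ≃ₜ O'.Surface} (hf : IsAffineBetween O O' 1 f) (hO : O.IsConnected) {i : ι}
    (hi : O.IsSingularCorner i) : ∃ e : ι → κ, IsTileMap O O' e := by
  have h_coord := hf.coord_eq hO hi
  let half : unitInterval := ⟨1 / 2, by norm_num⟩
  have h_centre : ∀ j, ∃ j', ∀ k,
      f (O.point j (midpoint k half)) = O'.point j' (midpoint k half) := by
    intro j
    obtain ⟨j', q, hq⟩ := O'.exists_point (f (O.point j (midpoint 0 half)))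
    refine ⟨j', fun k => ?_⟩
    obtain rfl : q = midpoint 0 half := Subtype.ext <| funext fun l => by
      have h := congrFun (h_coord (O.point j (midpoint 0 half))) l
      rwa [hq, coord_point, coord_point, toTorus_apply, toTorus_apply,
        unitAddCircle_coe_eq_coe_iff_of_mem_Ioo (q.mem_Icc l)
          (by rw [midpoint_half]; norm_num)] at h
    rwa [show midpoint k half = midpoint 0 half from
      Subtype.ext ((midpoint_half k).trans (midpoint_half 0).symm)]
  choose e he using h_centre
  have h_segment : ∀ k j r, f (O.point j (midpoint k r)) = O'.point (e j) (midpoint k r) :=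
    fun k j => eq_of_coord_eq
      (f.continuous.comp ((O.continuous_point j).comp (continuous_midpoint k)))
      ((O'.continuous_point _).comp (continuous_midpoint k))
      (fun r => h_coord _) (fun r => by rw [h_coord]; exact O.coord_midpoint_ne_zero k r j)
      (he j k)
  refine ⟨e, fun k j => O'.point_midpoint_injective k ?_⟩
  calc O'.point (e (O.side k j)) (midpoint k 0)
      = f (O.point (O.side k j) (midpoint k 0)) := (h_segment k _ 0).symm
    _ = f (O.point j (midpoint k 1)) := by rw [O.point_midpoint_one]
    _ = O'.point (e j) (midpoint k 1) := h_segment k j 1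
    _ = O'.point (O'.side k (e j)) (midpoint k 0) := O'.point_midpoint_one k _

/-! ### Construction of affine homeomorphisms -/

/-- The continuous map `D` to a square-tiled surface pulls the one-form of the surface back to the
differential of `pos`. -/
def IsDeveloped (O : SquareTiled ι) {X : Type} [TopologicalSpace X] (D : X → O.Surface)
    (pos : X → Fin 2 → ℝ) : Prop :=
  Continuous D ∧ ∀ V φ, O.IsPrimitive V φ → ∀ x, D x ∈ V →
    ∀ᶠ y in 𝓝 x, φ (D y) - φ (D x) = pos y - pos x

section Developed

variable {O : SquareTiled ι} {X Y : Type} [TopologicalSpace X] [TopologicalSpace Y]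
  {D : X → O.Surface} {pos : X → Fin 2 → ℝ}

lemma isDeveloped_point (i : ι) : O.IsDeveloped (O.point i) Subtype.val :=
  ⟨O.continuous_point i, fun _ _ hφ p hp => hφ i p hp⟩

lemma IsDeveloped.comp (hD : O.IsDeveloped D pos) {g : Y → X} (hg : Continuous g) :
    O.IsDeveloped (D ∘ g) (pos ∘ g) :=
  ⟨hD.1.comp hg, fun V φ hφ y hy => hg.continuousAt.eventually (hD.2 V φ hφ (g y) hy)⟩

lemma IsDeveloped.of_sub_eq_sub (hD : O.IsDeveloped D pos) {pos' : X → Fin 2 → ℝ}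
    (h : ∀ x y, pos' y - pos' x = pos y - pos x) : O.IsDeveloped D pos' :=
  ⟨hD.1, fun V φ hφ x hx => by simpa only [h] using hD.2 V φ hφ x hx⟩

lemma IsDeveloped.of_locallyFinite {β : Type} {K : β → Set X} (hK : LocallyFinite K)
    (h_closed : ∀ b, IsClosed (K b)) (h_cover : ⋃ b, K b = Set.univ)
    (hD : ∀ b, O.IsDeveloped (fun x : K b => D x) fun x => pos x) : O.IsDeveloped D pos := by
  refine ⟨hK.continuous h_cover h_closed fun b =>
    continuousOn_iff_continuous_domRestrict.2 (hD b).1, fun V φ hφ x hx => ?_⟩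
  have h_near : ∀ b ∈ {b | x ∈ K b}, ∀ᶠ y in 𝓝 x, y ∈ K b →
      φ (D y) - φ (D x) = pos y - pos x := fun b hb =>
    eventually_nhdsWithin_iff.1 <| (eventually_nhds_subtype_iff (K b) ⟨x, hb⟩
      fun y => φ (D y) - φ (D x) = pos y - pos x).1 ((hD b).2 V φ hφ ⟨x, hb⟩ hx)
  filter_upwards [hK.eventually_subset h_closed x,
    (eventually_all_finite (hK.point_finite x)).2 h_near] with y hy hy'
  obtain ⟨b, hb⟩ := Set.mem_iUnion.1 (h_cover ▸ Set.mem_univ y)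
  exact hy' b (hy hb) hb

end Developed

lemma AffinelyEquivalent.of_isDeveloped {O : SquareTiled ι} {O' : SquareTiled κ} {A : SL(2, ℝ)}
    (f : O.Surface ≃ O'.Surface)
    (hf : ∀ i, O'.IsDeveloped (fun p => f (O.point i p)) fun p => A • p.1)
    (hf' : ∀ i, O.IsDeveloped (fun p => f.symm (O'.point i p)) fun p => A⁻¹ • p.1) :
    AffinelyEquivalent O O' A := by
  refine ⟨⟨f, (O.continuous_iff_point _).2 fun i => (hf i).1,
    (O'.continuous_iff_point _).2 fun i => (hf' i).1⟩, fun U φ _ => ⟨fun hφ i p hp => ?_,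
    fun hφ i p hp => ?_⟩⟩
  · filter_upwards [(hf i).2 _ φ hφ p (Set.mem_image_of_mem f hp)] with q hq
    change A⁻¹ • φ (f (O.point i q)) - A⁻¹ • φ (f (O.point i p)) = _
    rw [← smul_sub, hq, ← smul_sub, inv_smul_smul]
  · have hp' : f.symm (O'.point i p) ∈ U := by
      obtain ⟨x, hx, hxp⟩ := hp
      exact (f.symm_apply_eq.2 hxp.symm : f.symm (O'.point i p) = x) ▸ hx
    filter_upwards [(hf' i).2 _ _ hφ p hp'] with q hq
    change A⁻¹ • φ (f (f.symm _)) - A⁻¹ • φ (f (f.symm _)) = _ at hq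
    rw [f.apply_symm_apply, f.apply_symm_apply, ← smul_sub, ← smul_sub] at hq
    exact smul_left_cancel _ hq

/-- The map on a square-tiled surface given by the maps `F i` on the squares. -/
def mapOfSquares (O : SquareTiled ι) {Y : Type} (F : ι → Square → Y)
    (h : ∀ k i (p q : Square), p.1 k = 1 → q.1 k = 0 → (∀ l, l ≠ k → p.1 l = q.1 l) →
      F i p = F (O.side k i) q) : O.Surface → Y :=
  Quot.lift (fun x => F x.1 x.2) fun x y hxy => by
    obtain ⟨k, hi, hx, hy, hxy⟩ := hxy.exists_side
    rw [hi, h k x.1 x.2 y.2 hx hy hxy]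

lemma AffinelyEquivalent.of_isTileMap {O : SquareTiled ι} {O' : SquareTiled κ} (e : ι ≃ κ)
    (he : IsTileMap O O' e) : AffinelyEquivalent O O' 1 := by
  have he' : IsTileMap O' O e.symm := fun k i => by
    rw [Equiv.symm_apply_eq, he, Equiv.apply_symm_apply]
  refine .of_isDeveloped
    ⟨O.mapOfSquares (fun i p => O'.point (e i) p) fun k i p q hp hq hpq => by
        rw [he, O'.point_eq_point_side k (e i) hp hq hpq],
      O'.mapOfSquares (fun i p => O.point (e.symm i) p) fun k i p q hp hq hpq => by
        rw [he', O.point_eq_point_side k (e.symm i) hp hq hpq],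
      fun x => ?_, fun x => ?_⟩
    (fun i => (isDeveloped_point (e i)).of_sub_eq_sub fun p q => by rw [one_smul, one_smul])
    (fun i => (isDeveloped_point (e.symm i)).of_sub_eq_sub fun p q => by
      rw [inv_one, one_smul, one_smul])
  · obtain ⟨i, p, rfl⟩ := O.exists_point x
    exact congrArg (O.point · p) (e.symm_apply_apply i)
  · obtain ⟨i, p, rfl⟩ := O'.exists_point x
    exact congrArg (O'.point · p) (e.apply_symm_apply i)

/-- The surface turned by a quarter turn counterclockwise. -/
def rotate (O : SquareTiled ι) : SquareTiled ι := ⟨O.v⁻¹, O.h⟩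

/-- The square turned by a quarter turn counterclockwise. -/
def Square.turn : Square ≃ₜ Square where
  toFun p := ⟨![1 - p.1 1, p.1 0], by
    obtain ⟨⟨h₀, h₀'⟩, h₁, h₁'⟩ := And.intro (p.mem_Icc 0) (p.mem_Icc 1)
    constructor <;> simp [Pi.le_def, Fin.forall_fin_two, *]⟩
  invFun p := ⟨![p.1 1, 1 - p.1 0], by
    obtain ⟨⟨h₀, h₀'⟩, h₁, h₁'⟩ := And.intro (p.mem_Icc 0) (p.mem_Icc 1)
    constructor <;> simp [Pi.le_def, Fin.forall_fin_two, *]⟩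
  left_inv p := by ext l; fin_cases l <;> simp
  right_inv p := by ext l; fin_cases l <;> simp
  continuous_toFun := by
    have := Square.continuous_apply
    refine .subtype_mk (continuous_pi <| Fin.forall_fin_two.2 ⟨?_, ?_⟩) _
    · exact continuous_const.sub (this 1)
    · exact this 0
  continuous_invFun := by
    have := Square.continuous_apply
    refine .subtype_mk (continuous_pi <| Fin.forall_fin_two.2 ⟨?_, ?_⟩) _
    · exact this 1
    · exact continuous_const.sub (this 0)

lemma S_smul (w : Fin 2 → ℝ) :
    ((ModularGroup.S : SL(2, ℤ)) : SL(2, ℝ)) • w = ![-w 1, w 0] := by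
  rw [Matrix.SpecialLinearGroup.smul_def, Matrix.SpecialLinearGroup.coe_matrix_coe,
    ModularGroup.coe_S]
  ext l
  fin_cases l <;> simp

lemma T_zpow_smul (m : ℤ) (w : Fin 2 → ℝ) :
    ((ModularGroup.T ^ m : SL(2, ℤ)) : SL(2, ℝ)) • w = ![w 0 + m * w 1, w 1] := by
  rw [Matrix.SpecialLinearGroup.smul_def, Matrix.SpecialLinearGroup.coe_matrix_coe,
    ModularGroup.coe_T_zpow]
  ext l
  fin_cases l <;> simp

lemma affinelyEquivalent_rotate (O : SquareTiled ι) :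
    AffinelyEquivalent O O.rotate ((ModularGroup.S : SL(2, ℤ)) : SL(2, ℝ)) := by
  refine .of_isDeveloped
    ⟨O.mapOfSquares (fun i p => O.rotate.point i p.turn) fun k i p q hp hq hpq => ?_,
      O.rotate.mapOfSquares (fun i p => O.point i (Square.turn.symm p)) fun k i p q hp hq hpq => ?_,
      fun x => ?_, fun x => ?_⟩
    (fun i => ((isDeveloped_point i).comp Square.turn.continuous).of_sub_eq_sub fun p q => ?_)
    (fun i => ((isDeveloped_point i).comp Square.turn.symm.continuous).of_sub_eq_sub
      fun p q => ?_)
  · fin_cases k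
    · exact O.rotate.point_eq_point_side 1 i hp hq (by simp [Square.turn, hpq])
    · have h := O.rotate.point_eq_point_side 0 (O.v i) (p := q.turn) (q := p.turn)
        (by simpa [Square.turn] using hq)
        (by simpa [Square.turn, sub_eq_zero] using hp.symm) (by simp [Square.turn, hpq])
      simpa [side, rotate] using h.symm
  · fin_cases k
    · have h := O.point_eq_point_side 1 (O.v⁻¹ i) (p := Square.turn.symm q)
        (q := Square.turn.symm p) (by simpa [Square.turn] using hq)
        (by simpa [Square.turn, sub_eq_zero] using hp.symm) (by simp [Square.turn, hpq])
      simpa [side, rotate] using h.symm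
    · exact O.point_eq_point_side 0 i hp hq (by simp [Square.turn, hpq])
  · obtain ⟨i, p, rfl⟩ := O.exists_point x
    exact congrArg (O.point i) (Square.turn.symm_apply_apply p)
  · obtain ⟨i, p, rfl⟩ := O.rotate.exists_point x
    exact congrArg (O.rotate.point i) (Square.turn.apply_symm_apply p)
  · rw [← smul_sub, S_smul]
    ext l
    fin_cases l <;> simp [Square.turn]
  · rw [← smul_sub, inv_smul_eq_iff, S_smul]
    ext l
    fin_cases l <;> simp [Square.turn]

/-- The surface after the shear `(x, y) ↦ (x + y, y)`. -/
def shear (O : SquareTiled ι) : SquareTiled ι := ⟨O.h, O.v * O.h⁻¹⟩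

/-- The point of the unit square with the coordinates `s` and `t`. -/
def Square.ofCoords (s t : unitInterval) : Square :=
  ⟨![s, t], Pi.le_def.2 (Fin.forall_fin_two.2 ⟨s.2.1, t.2.1⟩),
    Pi.le_def.2 (Fin.forall_fin_two.2 ⟨s.2.2, t.2.2⟩)⟩

lemma Square.continuous_ofCoords :
    Continuous fun x : unitInterval × unitInterval => Square.ofCoords x.1 x.2 :=
  .subtype_mk (continuous_pi <| Fin.forall_fin_two.2
    ⟨continuous_subtype_val.comp continuous_fst, continuous_subtype_val.comp continuous_snd⟩) _

/-- The strip `ℝ × [0, 1]` wrapped around the row of squares through `i`. -/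
noncomputable def strip (O : SquareTiled ι) (i : ι) (x : ℝ × unitInterval) : O.Surface :=
  O.point ((O.h ^ ⌊x.1⌋) i)
    (Square.ofCoords ⟨Int.fract x.1, Int.fract_nonneg _, (Int.fract_lt_one _).le⟩ x.2)

section Strip

variable (O : SquareTiled ι)

lemma strip_eq_point (i : ι) (n : ℤ) {s : ℝ} (hs : s - n ∈ unitInterval) (t : unitInterval) :
    O.strip i (s, t) = O.point ((O.h ^ n) i) (Square.ofCoords ⟨s - n, hs⟩ t) := by
  rcases hs.2.lt_or_eq with h_lt | h_eq
  · have h_floor : ⌊s⌋ = n := Int.floor_eq_iff.2 ⟨by linarith [hs.1], by linarith⟩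
    simp only [strip, Int.fract, h_floor]
  · obtain rfl : s = n + 1 := by linarith
    have h_floor : ⌊(n + 1 : ℝ)⌋ = 1 + n := by rw [Int.floor_add_one, Int.floor_intCast, add_comm]
    rw [strip, h_floor, zpow_one_add]
    exact (O.point_eq_point_side 0 _ (by simp [Square.ofCoords]) (by simp [Square.ofCoords])
      (by simp [Fin.forall_fin_two, Square.ofCoords])).symm

lemma strip_zpow (i : ι) (n : ℤ) (s : ℝ) (t : unitInterval) :
    O.strip ((O.h ^ n) i) (s, t) = O.strip i (s + n, t) := by
  simp only [strip, Int.floor_add_intCast, Int.fract_add_intCast, zpow_add, Equiv.Perm.mul_apply]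

lemma strip_apply_coords (i : ι) (p : Square) :
    O.strip i (p.1 0, ⟨p.1 1, p.mem_Icc 1⟩) = O.point i p := by
  rw [O.strip_eq_point i 0 (by simpa using p.mem_Icc 0), zpow_zero, Equiv.Perm.one_apply]
  congr 1
  ext l
  fin_cases l <;> simp [Square.ofCoords]

lemma strip_one_eq_strip_zero (i : ι) {s : ℝ} (hs : s ∈ unitInterval) :
    O.strip i (s, 1) = O.strip (O.v i) (s, 0) := by
  rw [O.strip_eq_point i 0 (by simpa using hs), O.strip_eq_point (O.v i) 0 (by simpa using hs)]
  exact O.point_eq_point_side 1 i rfl rfl (by simp [Fin.forall_fin_two, Square.ofCoords])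

lemma isDeveloped_strip (i : ι) : O.IsDeveloped (O.strip i) fun x => ![x.1, x.2] := by
  refine .of_locallyFinite (K := fun n : ℤ => {x : ℝ × unitInterval | x.1 - n ∈ unitInterval})
    (fun x => ⟨{y | y.1 ∈ Set.Ioo (x.1 - 1) (x.1 + 1)}, isOpen_Ioo.preimage continuous_fst
      |>.mem_nhds (by simp), (Set.finite_Icc (⌊x.1⌋ - 2) (⌊x.1⌋ + 2)).subset ?_⟩)
    (fun n => isClosed_Icc.preimage (continuous_fst.sub continuous_const))
    (Set.iUnion_eq_univ_iff.2 fun x =>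
      ⟨⌊x.1⌋, Int.fract_nonneg x.1, (Int.fract_lt_one x.1).le⟩) fun n => ?_
  · rintro n ⟨y, ⟨hy₀, hy₁⟩, h₀, h₁⟩
    have h_floor := Int.floor_le x.1
    have h_floor' := Int.lt_floor_add_one x.1
    have h_le : (⌊x.1⌋ - 2 : ℝ) ≤ n := by linarith
    have h_ge : (n : ℝ) ≤ ⌊x.1⌋ + 2 := by linarith
    exact ⟨by exact_mod_cast h_le, by exact_mod_cast h_ge⟩
  · let g (x : {x : ℝ × unitInterval | x.1 - n ∈ unitInterval}) : Square :=
      Square.ofCoords ⟨x.1.1 - n, x.2⟩ x.1.2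
    have hg : Continuous g := Square.continuous_ofCoords.comp
      (.prodMk (.subtype_mk (by fun_prop) _) (by fun_prop))
    rw [show (fun x => O.strip i x.1) = O.point ((O.h ^ n) i) ∘ g from
      funext fun x => O.strip_eq_point i n x.2 x.1.2]
    refine ((isDeveloped_point _).comp hg).of_sub_eq_sub fun x y => ?_
    ext l
    fin_cases l <;> simp [g, Square.ofCoords]

end Strip

/-- The surface `O'` arises from `O` by the shear `(x, y) ↦ (x + m * y, y)`: the row of squares
above each row is displaced by `m` squares. -/
def IsShear (O O' : SquareTiled ι) (m : ℤ) : Prop :=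
  O'.h = O.h ∧ ∀ i, O'.v ((O.h ^ m) i) = O.v i

section Shear

variable {O O' : SquareTiled ι} {m : ℤ}

lemma IsShear.symm (h : IsShear O O' m) : IsShear O' O (-m) :=
  ⟨h.1.symm, fun i => by rw [h.1, ← h.2, zpow_neg, Equiv.Perm.inv_def, Equiv.apply_symm_apply]⟩

/-- The map that shears every square into the strip of its row. -/
noncomputable def IsShear.map (h : IsShear O O' m) : O.Surface → O'.Surface :=
  O.mapOfSquares (fun i p => O'.strip i (p.1 0 + m * p.1 1, ⟨p.1 1, p.mem_Icc 1⟩))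
    fun k i p q hp hq hpq => by
      fin_cases k
      · have h_next := O'.strip_zpow i 1 (q.1 0 + m * q.1 1) ⟨q.1 1, q.mem_Icc 1⟩
        rw [zpow_one, h.1, Int.cast_one] at h_next
        simpa [side, show p.1 0 = 1 from hp, show q.1 0 = 0 from hq, hpq 1 (by decide),
          add_comm] using h_next.symm
      · have hp₀ : p.1 0 = q.1 0 := hpq 0 (by decide)
        have h_top := O'.strip_one_eq_strip_zero ((O.h ^ m) i) (q.mem_Icc 0)
        rw [h.2, ← h.1, strip_zpow] at h_top
        simpa [side, show p.1 1 = 1 from hp, show q.1 1 = 0 from hq, hp₀] using h_top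

lemma IsShear.map_point (h : IsShear O O' m) (i : ι) (p : Square) :
    h.map (O.point i p) = O'.strip i (p.1 0 + m * p.1 1, ⟨p.1 1, p.mem_Icc 1⟩) := rfl

lemma IsShear.map_strip (h : IsShear O O' m) (i : ι) (s : ℝ) (t : unitInterval) :
    h.map (O.strip i (s, t)) = O'.strip i (s + m * t, t) := by
  rw [strip, h.map_point, ← h.1, strip_zpow]
  congr 2
  change Int.fract s + m * (t : ℝ) + ⌊s⌋ = s + m * t
  rw [add_right_comm, Int.fract_add_floor]

lemma IsShear.map_map (h : IsShear O O' m) {n : ℤ} (h' : IsShear O' O n) (hmn : m + n = 0)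
    (x : O.Surface) : h'.map (h.map x) = x := by
  obtain ⟨i, p, rfl⟩ := O.exists_point x
  obtain rfl := eq_neg_of_add_eq_zero_right hmn
  rw [h.map_point, h'.map_strip, ← O.strip_apply_coords]
  push_cast
  congr 2
  ring

lemma IsShear.isDeveloped_map (h : IsShear O O' m) (i : ι) : O'.IsDeveloped
    (fun p => h.map (O.point i p))
    fun p => ((ModularGroup.T ^ m : SL(2, ℤ)) : SL(2, ℝ)) • p.1 := by
  have h_continuous := Square.continuous_apply
  refine ((O'.isDeveloped_strip i).comp
    (g := fun p : Square => (p.1 0 + m * p.1 1, ⟨p.1 1, p.mem_Icc 1⟩)) ?_).of_sub_eq_sub ?_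
  · exact ((h_continuous 0).add (continuous_const.mul (h_continuous 1))).prodMk
      (.subtype_mk (h_continuous 1) _)
  · intro p q
    simp only [T_zpow_smul, Function.comp_apply]

lemma IsShear.affinelyEquivalent (h : IsShear O O' m) :
    AffinelyEquivalent O O' ((ModularGroup.T ^ m : SL(2, ℤ)) : SL(2, ℝ)) := by
  refine .of_isDeveloped ⟨h.map, h.symm.map, h.map_map h.symm (add_neg_cancel m),
    h.symm.map_map h (neg_add_cancel m)⟩ h.isDeveloped_map fun i => ?_
  rw [← map_inv, ← zpow_neg]
  exact h.symm.isDeveloped_map i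

end Shear

lemma affinelyEquivalent_shear (O : SquareTiled ι) :
    AffinelyEquivalent O O.shear ((ModularGroup.T : SL(2, ℤ)) : SL(2, ℝ)) := by
  have h : IsShear O O.shear 1 := ⟨rfl, fun i => by simp [shear]⟩
  simpa only [zpow_one] using h.affinelyEquivalent

end SquareTiled

namespace SquareTiled

variable {ι κ μ J : Type}

/-! ### The action of `SL(2, ℤ)` on square-tiled surfaces -/

/-- The generators `S` (for `false`) and `T` (for `true`) of `SL(2, ℤ)`. -/
def generator (b : Bool) : SL(2, ℤ) := cond b ModularGroup.T ModularGroup.S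

lemma closure_range_generator : Subgroup.closure (Set.range generator) = ⊤ := by
  rw [Bool.range_eq, ← SpecialLinearGroup.SL2Z_generators]
  rfl

/-- The action of the generators of `SL(2, ℤ)` on square-tiled surfaces. -/
def move (O : SquareTiled ι) (b : Bool) : SquareTiled ι := cond b O.shear O.rotate

lemma affinelyEquivalent_move (O : SquareTiled ι) (b : Bool) :
    AffinelyEquivalent O (O.move b) (generator b : SL(2, ℝ)) := by
  cases b
  · exact affinelyEquivalent_rotate O
  · exact affinelyEquivalent_shear O

lemma IsConnected.move {O : SquareTiled ι} (hO : O.IsConnected) (b : Bool) :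
    (O.move b).IsConnected := by
  intro s hs h
  cases b
  · exact hO s hs (Fin.forall_fin_two.2
      ⟨h 1, fun i => by simpa [side, SquareTiled.move, rotate] using (h 0 (O.v i)).symm⟩)
  · exact hO s hs (Fin.forall_fin_two.2 ⟨h 0, fun i => ((h 0 i).symm.trans
      (by simpa [side, SquareTiled.move, shear] using (h 1 (O.h i)).symm)).symm⟩)

lemma commute_move_iff {O : SquareTiled ι} (b : Bool) :
    Commute (O.move b).h (O.move b).v ↔ Commute O.h O.v := by
  cases b
  · exact Commute.inv_left_iff.trans ⟨Commute.symm, Commute.symm⟩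
  · refine ⟨fun h => ?_, fun h => h.mul_right (Commute.refl O.h).inv_right⟩
    simpa [move, shear] using h.mul_right (Commute.refl O.h)

/-- The action of a word in the generators, whose last letter acts first. -/
def moves (O : SquareTiled ι) (w : List Bool) : SquareTiled ι := w.foldr (fun b O => O.move b) O

lemma IsConnected.moves {O : SquareTiled ι} (hO : O.IsConnected) (w : List Bool) :
    (O.moves w).IsConnected := by
  induction w with
  | nil => exact hO
  | cons b w ih => exact ih.move b

lemma commute_moves_iff {O : SquareTiled ι} (w : List Bool) :
    Commute (O.moves w).h (O.moves w).v ↔ Commute O.h O.v := by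
  induction w with
  | nil => rfl
  | cons b w ih => exact (commute_move_iff b).trans ih

/-! ### Isomorphisms of square-tiled surfaces -/

section IsTileMap

variable {O : SquareTiled ι} {O' : SquareTiled κ} {O'' : SquareTiled μ} {e : ι → κ}

lemma IsTileMap.semiconj (he : IsTileMap O O' e) (k : Fin 2) :
    Function.Semiconj e (O.side k) (O'.side k) := he k

lemma IsTileMap.semiconj_inv (he : IsTileMap O O' e) (k : Fin 2) :
    Function.Semiconj e ⇑(O.side k)⁻¹ ⇑(O'.side k)⁻¹ :=
  (he.semiconj k).inverses_right (O.side k).right_inv (O'.side k).left_inv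

lemma IsTileMap.move (he : IsTileMap O O' e) (b : Bool) : IsTileMap (O.move b) (O'.move b) e := by
  cases b
  · exact Fin.forall_fin_two.2 ⟨he.semiconj_inv 1, he.semiconj 0⟩
  · exact Fin.forall_fin_two.2
      ⟨he.semiconj 0, (he.semiconj 1).comp_right (he.semiconj_inv 0)⟩

lemma IsTileMap.surjective [Nonempty ι] (he : IsTileMap O O' e) (hO' : O'.IsConnected) :
    Function.Surjective e := by
  refine Set.range_eq_univ.1 (hO' _ (Set.range_nonempty e) fun k x => ⟨?_, ?_⟩)
  · rintro ⟨i, hi⟩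
    exact ⟨(O.side k)⁻¹ i, by rw [he.semiconj_inv, hi, Equiv.Perm.inv_eq_iff_eq]⟩
  · rintro ⟨i, rfl⟩
    exact ⟨O.side k i, he k i⟩

/-- Two square-tiled surfaces differ by a relabelling of the squares. -/
def Isomorphic (O : SquareTiled ι) (O' : SquareTiled κ) : Prop :=
  ∃ e : ι ≃ κ, IsTileMap O O' e

lemma IsTileMap.isomorphic (he : IsTileMap O O' e) (h_bij : Function.Bijective e) :
    Isomorphic O O' :=
  ⟨.ofBijective e h_bij, he⟩

lemma Isomorphic.refl (O : SquareTiled ι) : Isomorphic O O := ⟨.refl ι, fun _ _ => rfl⟩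

lemma Isomorphic.symm (h : Isomorphic O O') : Isomorphic O' O := by
  obtain ⟨e, he⟩ := h
  exact ⟨e.symm, fun k i => by rw [Equiv.symm_apply_eq, he, e.apply_symm_apply]⟩

lemma Isomorphic.trans (h : Isomorphic O O') (h' : Isomorphic O' O'') : Isomorphic O O'' := by
  obtain ⟨e, he⟩ := h
  obtain ⟨e', he'⟩ := h'
  exact ⟨e.trans e', fun k => (he'.semiconj k).comp_left (he.semiconj k)⟩

lemma Isomorphic.move (h : Isomorphic O O') (b : Bool) : Isomorphic (O.move b) (O'.move b) :=
  h.imp fun _ he => he.move b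

lemma Isomorphic.affinelyEquivalent (h : Isomorphic O O') : AffinelyEquivalent O O' 1 := by
  obtain ⟨e, he⟩ := h
  exact .of_isTileMap e he

lemma Isomorphic.pow_eq_one (h : Isomorphic O O') {n : ℕ} (hn : O.h ^ n = 1) : O'.h ^ n = 1 := by
  obtain ⟨e, he⟩ := h
  ext x
  obtain ⟨i, rfl⟩ := e.surjective x
  have h_iterate := ((he.semiconj 0).iterate_right n).eq i
  change e (O.h^[n] i) = O'.h^[n] (e i) at h_iterate
  rw [Equiv.Perm.iterate_eq_pow, Equiv.Perm.iterate_eq_pow, hn] at h_iterate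
  exact h_iterate.symm

lemma AffinelyEquivalent.isomorphic [Finite ι] [Nonempty ι] {O O' : SquareTiled ι}
    (h : AffinelyEquivalent O O' 1) (hO : O.IsConnected) (hO' : O'.IsConnected)
    (h_comm : ¬Commute O.h O.v) : Isomorphic O O' := by
  obtain ⟨f, hf⟩ := h
  obtain ⟨i, hi⟩ : ∃ i, O.IsSingularCorner i := by
    by_contra! h
    exact h_comm (Equiv.ext fun i => not_not.1 (h i))
  obtain ⟨e, he⟩ := hf.exists_isTileMap hO hi
  have h_surj := he.surjective hO'
  exact he.isomorphic ⟨Finite.injective_iff_surjective.2 h_surj, h_surj⟩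

end IsTileMap

/-! ### The Veech group as a stabilizer -/

/-- The surfaces `X j` represent, up to isomorphism, an invariant set of square-tiled surfaces
under the action of `SL(2, ℤ)`, on which the generators act by `ρ`. -/
structure IsInvariantFamily (X : J → SquareTiled ι) (ρ : Bool → J → J) : Prop where
  isConnected : ∀ j, (X j).IsConnected
  not_commute : ∀ j, ¬Commute (X j).h (X j).v
  isomorphic_move : ∀ b j, Isomorphic ((X j).move b) (X (ρ b j))
  surjective : ∀ b, Function.Surjective (ρ b)
  eq_of_isomorphic : ∀ j k, Isomorphic (X j) (X k) → j = k

/-- The map `c` identifies the cosets `A Γ` with the elements of a set on which the generators of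
`SL(2, ℤ)` act by `ρ`. -/
structure IsCosetLabelling (Γ : Subgroup SL(2, ℤ)) (c : SL(2, ℤ) → J) (ρ : Bool → J → J) :
    Prop where
  apply_generator_mul : ∀ b A, c (generator b * A) = ρ b (c A)
  apply_eq_iff : ∀ A B, c A = c B ↔ A⁻¹ * B ∈ Γ

lemma IsAffineBetween.exists_intCast_eq {O : SquareTiled ι} {O' : SquareTiled κ} {A : SL(2, ℝ)}
    {f : O.Surface ≃ₜ O'.Surface} (hf : IsAffineBetween O O' A f)
    (hO : ∀ k, O.HasSingularSide k) : ∃ B : SL(2, ℤ), (B : SL(2, ℝ)) = A := by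
  choose B hB using fun l k => hf.exists_int (hO k) l
  have h_matrix : A.1 = (Matrix.of B).map (Int.castRingHom ℝ) := Matrix.ext hB
  have h_det : ((Matrix.of B).det : ℝ) = 1 := by
    rw [← A.2, h_matrix, ← RingHom.mapMatrix_apply, ← RingHom.map_det, eq_intCast]
  exact ⟨⟨Matrix.of B, by exact_mod_cast h_det⟩, Subtype.ext h_matrix.symm⟩

namespace IsInvariantFamily

variable {X : J → SquareTiled ι} {ρ : Bool → J → J}

lemma affinelyEquivalent (hX : IsInvariantFamily X ρ) (b : Bool) (j : J) :
    AffinelyEquivalent (X j) (X (ρ b j)) (generator b : SL(2, ℝ)) := by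
  simpa only [one_mul] using
    (affinelyEquivalent_move (X j) b).trans (hX.isomorphic_move b j).affinelyEquivalent

lemma exists_affinelyEquivalent (hX : IsInvariantFamily X ρ) (A : SL(2, ℤ)) (j : J) :
    ∃ k, AffinelyEquivalent (X j) (X k) (A : SL(2, ℝ)) := by
  have hA : A ∈ Subgroup.closure (Set.range generator) := closure_range_generator ▸ trivial
  induction hA using Subgroup.closure_induction_left generalizing j with
  | one => exact ⟨j, by simpa using (Isomorphic.refl (X j)).affinelyEquivalent⟩
  | mul_left g hg A _ ih =>
    obtain ⟨b, rfl⟩ := hg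
    obtain ⟨k, hk⟩ := ih j
    exact ⟨ρ b k, by simpa only [map_mul] using hk.trans (hX.affinelyEquivalent b k)⟩
  | inv_mul_cancel g hg A _ ih =>
    obtain ⟨b, rfl⟩ := hg
    obtain ⟨k, hk⟩ := ih j
    obtain ⟨l, rfl⟩ := hX.surjective b k
    exact ⟨l, by simpa only [map_mul, map_inv] using hk.trans (hX.affinelyEquivalent b l).symm⟩

variable [Finite ι] [Nonempty ι]

lemma eq_of_affinelyEquivalent (hX : IsInvariantFamily X ρ) {C : SquareTiled κ} {A : SL(2, ℝ)}
    {j k : J} (hj : AffinelyEquivalent C (X j) A) (hk : AffinelyEquivalent C (X k) A) : j = k := by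
  have h : AffinelyEquivalent (X j) (X k) 1 := by simpa only [mul_inv_cancel] using hj.symm.trans hk
  exact hX.eq_of_isomorphic j k
    (h.isomorphic (hX.isConnected j) (hX.isConnected k) (hX.not_commute j))

theorem exists_isCosetLabelling (hX : IsInvariantFamily X ρ) {C : SquareTiled κ} {j₀ : J}
    (hC : Isomorphic C (X j₀)) (h_side : ∀ k, (X j₀).HasSingularSide k) :
    ∃ Γ : Subgroup SL(2, ℤ),
      C.veechGroup = Γ.map (Matrix.SpecialLinearGroup.map (Int.castRingHom ℝ)) ∧
      ∃ c, c 1 = j₀ ∧ IsCosetLabelling Γ c ρ := by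
  have hC' := hC.affinelyEquivalent
  have h_exists (A : SL(2, ℤ)) : ∃ j, AffinelyEquivalent C (X j) (A : SL(2, ℝ)) := by
    obtain ⟨j, hj⟩ := hX.exists_affinelyEquivalent A j₀
    exact ⟨j, by simpa only [mul_one] using hC'.trans hj⟩
  choose c hc using h_exists
  have h_integral : C.veechGroup ≤ (Matrix.SpecialLinearGroup.map (Int.castRingHom ℝ)).range := by
    intro A hA
    obtain ⟨f, hf⟩ := (hC'.symm.trans hA).trans hC'
    obtain ⟨B, hB⟩ := hf.exists_intCast_eq h_side
    exact ⟨B, by simpa using hB⟩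
  refine ⟨C.veechGroup.comap _, (Subgroup.map_comap_eq_self h_integral).symm, c,
    hX.eq_of_affinelyEquivalent (hc 1) (by simpa only [map_one] using hC'), fun b A => ?_,
    fun A B => ⟨fun h => ?_, fun h => ?_⟩⟩
  · refine hX.eq_of_affinelyEquivalent (hc _) ?_
    simpa only [map_mul] using (hc A).trans (hX.affinelyEquivalent b (c A))
  · rw [Subgroup.mem_comap, mem_veechGroup_iff, map_mul, map_inv]
    exact (h ▸ hc B).trans (hc A).symm
  · rw [Subgroup.mem_comap, mem_veechGroup_iff] at h
    refine hX.eq_of_affinelyEquivalent ?_ (hc B)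
    simpa only [← map_mul, mul_inv_cancel_left] using AffinelyEquivalent.trans h (hc A)

end IsInvariantFamily

/-- The action of a word in the generators on an index set. -/
def moveIndex (ρ : Bool → J → J) (w : List Bool) (j : J) : J := w.foldr ρ j

/-- The surfaces are distinguished by the order of the horizontal permutation of their images under
the words `test`. -/
theorem isInvariantFamily_of_moves {O : SquareTiled ι} {ρ : Bool → J → J} (hO : O.IsConnected)
    (h_comm : ¬Commute O.h O.v) (w : J → List Bool)
    (h_move : ∀ b j, Isomorphic ((O.moves (w j)).move b) (O.moves (w (ρ b j))))
    (h_surj : ∀ b, Function.Surjective (ρ b)) (n : ℕ) (test : List (List Bool))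
    (h_test : ∀ j k, (∀ u ∈ test, (O.moves (w (moveIndex ρ u j))).h ^ n = 1 ↔
      (O.moves (w (moveIndex ρ u k))).h ^ n = 1) → j = k) :
    IsInvariantFamily (fun j => O.moves (w j)) ρ where
  isConnected _ := hO.moves _
  not_commute _ := (commute_moves_iff _).not.2 h_comm
  isomorphic_move := h_move
  surjective := h_surj
  eq_of_isomorphic j k hjk := by
    have h_word (u : List Bool) :
        Isomorphic (O.moves (w (moveIndex ρ u j))) (O.moves (w (moveIndex ρ u k))) := by
      induction u with
      | nil => exact hjk
      | cons b u ih => exact ((h_move b _).symm.trans (ih.move b)).trans (h_move b _)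
    exact h_test j k fun u _ => ⟨(h_word u).pow_eq_one, (h_word u).symm.pow_eq_one⟩

end SquareTiled

namespace SquareTiled

open ModularGroup Matrix.SpecialLinearGroup

/-! ### Cusps and the action on cosets -/

/-- The image of the cusp `∞` under an element of `SL(2, ℤ)`. -/
noncomputable abbrev cuspOf (g : SL(2, ℤ)) : OnePoint ℝ := mapGL ℝ g • OnePoint.infty

lemma mapGL_smul_cuspOf (g g' : SL(2, ℤ)) : mapGL ℝ g • cuspOf g' = cuspOf (g * g') := by
  rw [cuspOf, cuspOf, map_mul, mul_smul]

lemma cuspOf_eq_infty_iff {g : SL(2, ℤ)} :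
    cuspOf g = OnePoint.infty ↔ ∃ k : ℤ, g = T ^ k ∨ g = -T ^ k := by
  have h_lower : cuspOf g = OnePoint.infty ↔ g.1 1 0 = 0 := by
    simp [cuspOf, OnePoint.smul_infty_eq_self_iff]
  refine h_lower.trans ⟨fun h => ?_, ?_⟩
  · have h_det := g.2
    rw [Matrix.det_fin_two, h, mul_zero, sub_zero] at h_det
    rcases Int.mul_eq_one_iff_eq_one_or_neg_one.1 h_det with ⟨h₀, h₁⟩ | ⟨h₀, h₁⟩
    · refine ⟨g.1 0 1, Or.inl ?_⟩
      ext i j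
      fin_cases i <;> fin_cases j <;> simp [coe_T_zpow, h₀, h₁, h]
    · refine ⟨-g.1 0 1, Or.inr ?_⟩
      ext i j
      fin_cases i <;> fin_cases j <;> simp [coe_T_zpow, h₀, h₁, h]
  · rintro ⟨k, rfl | rfl⟩ <;> simp [coe_T_zpow]

lemma cuspOf_mul_T_zpow (g : SL(2, ℤ)) (k : ℤ) : cuspOf (g * T ^ k) = cuspOf g := by
  rw [← mapGL_smul_cuspOf, cuspOf_eq_infty_iff.2 ⟨k, Or.inl rfl⟩]

lemma exists_eq_mul_T_zpow {g g' : SL(2, ℤ)} (h : cuspOf g = cuspOf g') :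
    ∃ k : ℤ, g = g' * T ^ k ∨ g = -(g' * T ^ k) := by
  have h_infty : cuspOf (g'⁻¹ * g) = OnePoint.infty := by
    rw [← mapGL_smul_cuspOf, h, mapGL_smul_cuspOf, inv_mul_cancel, cuspOf, map_one, one_smul]
  obtain ⟨k, hk⟩ := cuspOf_eq_infty_iff.1 h_infty
  exact ⟨k, by simpa only [inv_mul_eq_iff_eq_mul, mul_neg] using hk⟩

lemma isCusp_iff_exists_cuspOf_eq (Γ : Subgroup SL(2, ℤ)) [Γ.FiniteIndex] (x : OnePoint ℝ) :
    IsCusp x (Γ : Subgroup (GL (Fin 2) ℝ)) ↔ ∃ g, cuspOf g = x := by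
  rw [Subgroup.IsArithmetic.isCusp_iff_isCusp_SL2Z, isCusp_SL2Z_iff']
  simp only [eq_comm]

/-- The element of `SL(2, ℤ)` given by a word in the generators. -/
def wordMatrix (w : List Bool) : SL(2, ℤ) := (w.map generator).prod

namespace IsCosetLabelling

variable {J : Type} {Γ : Subgroup SL(2, ℤ)} {c : SL(2, ℤ) → J} {ρ : Bool → J → J}

lemma apply_wordMatrix (hc : IsCosetLabelling Γ c ρ) (w : List Bool) :
    c (wordMatrix w) = moveIndex ρ w (c 1) := by
  induction w with
  | nil => rfl
  | cons b w ih =>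
    exact (hc.apply_generator_mul b (wordMatrix w)).trans (congrArg (ρ b) ih)

lemma apply_T_pow_mul (hc : IsCosetLabelling Γ c ρ) (n : ℕ) (A : SL(2, ℤ)) :
    c (T ^ n * A) = (ρ true)^[n] (c A) := by
  induction n with
  | zero => rw [pow_zero, one_mul, Function.iterate_zero_apply]
  | succ n ih =>
    rw [pow_succ', mul_assoc, Function.iterate_succ_apply', ← ih]
    exact hc.apply_generator_mul true _

lemma apply_neg (hc : IsCosetLabelling Γ c ρ) (hρ : Function.Involutive (ρ false))
    (A : SL(2, ℤ)) : c (-A) = c A := by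
  have h_sq : -A = generator false * (generator false * A) := by
    rw [← mul_assoc, show generator false * generator false = -1 by decide, neg_one_mul]
  rw [h_sq, hc.apply_generator_mul, hc.apply_generator_mul, hρ]

lemma apply_mul_of_mem (hc : IsCosetLabelling Γ c ρ) (A : SL(2, ℤ)) {γ : SL(2, ℤ)}
    (hγ : γ ∈ Γ) : c (A * γ) = c A := by
  rw [eq_comm, hc.apply_eq_iff, inv_mul_cancel_left]
  exact hγ

/-- Equivalence of cusps under `Γ` is equivalence of cosets under the powers of `T`. -/
lemma exists_cuspOf_mul_eq_iff (hc : IsCosetLabelling Γ c ρ) (h_neg : ∀ A, c (-A) = c A)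
    {g g' : SL(2, ℤ)} :
    (∃ γ ∈ Γ, cuspOf (γ * g) = cuspOf g') ↔ ∃ k : ℤ, c g'⁻¹ = c (T ^ k * g⁻¹) := by
  constructor
  · rintro ⟨γ, hγ, h⟩
    obtain ⟨k, hk⟩ := exists_eq_mul_T_zpow h.symm
    have h_coset : c g'⁻¹ = c (T ^ (-k) * g⁻¹ * γ⁻¹) := by
      rcases hk with rfl | rfl
      · congr 1
        group
      · rw [inv_neg, h_neg]
        congr 1
        group
    exact ⟨-k, h_coset.trans (hc.apply_mul_of_mem _ (Γ.inv_mem hγ))⟩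
  · rintro ⟨k, hk⟩
    refine ⟨_, (hc.apply_eq_iff _ _).1 hk, ?_⟩
    rw [inv_inv, mul_assoc, inv_mul_cancel_right, cuspOf_mul_T_zpow]

lemma mul_T_pow_mul_inv_mem_iff (hc : IsCosetLabelling Γ c ρ) (h_neg : ∀ A, c (-A) = c A)
    {g g' : SL(2, ℤ)} (h : cuspOf g = cuspOf g') (n : ℕ) :
    (g * T ^ n * g⁻¹ ∈ Γ ∨ -(g * T ^ n * g⁻¹) ∈ Γ) ↔
      Function.IsPeriodicPt (ρ true) n (c g'⁻¹) := by
  have h_conj : g * T ^ n * g⁻¹ = g'⁻¹⁻¹ * (T ^ n * g'⁻¹) := by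
    obtain ⟨k, rfl | rfl⟩ := exists_eq_mul_T_zpow h
    · group
    · rw [inv_neg, neg_mul, neg_mul_neg]
      group
  rw [h_conj, ← mul_neg, ← hc.apply_eq_iff, ← hc.apply_eq_iff, h_neg, or_self,
    hc.apply_T_pow_mul, eq_comm]
  rfl

lemma exists_iterate_eq_of_isPeriodicPt (hc : IsCosetLabelling Γ c ρ) {A : SL(2, ℤ)} {n : ℕ}
    (hn : 0 < n) (hA : Function.IsPeriodicPt (ρ true) n (c A)) (k : ℤ) :
    ∃ m < n, c (T ^ k * A) = (ρ true)^[m] (c A) := by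
  have h_period (q : ℤ) : c (T ^ (n * q) * A) = c A := by
    have h_mem : A⁻¹ * T ^ n * A ∈ Γ := by
      rw [mul_assoc, ← hc.apply_eq_iff, hc.apply_T_pow_mul, hA.eq]
    have h_zpow : T ^ (n * q) * A = A * (A⁻¹ * T ^ n * A) ^ q := by
      rw [show A⁻¹ * T ^ n * A = A⁻¹ * T ^ n * A⁻¹⁻¹ by rw [inv_inv], conj_zpow, zpow_mul,
        zpow_natCast]
      group
    rw [h_zpow, hc.apply_mul_of_mem A (Γ.zpow_mem h_mem q)]
  obtain ⟨m, hm⟩ := Int.eq_ofNat_of_zero_le (Int.emod_nonneg k (by omega : (n : ℤ) ≠ 0))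
  have h_lt := Int.emod_lt_of_pos k (by omega : (0 : ℤ) < n)
  refine ⟨m, by omega, ?_⟩
  rw [← Int.emod_add_mul_ediv k n, hm, zpow_add, mul_assoc, zpow_natCast, hc.apply_T_pow_mul,
    h_period]

end IsCosetLabelling

/-- The list `R` contains representatives of the orbits of `T` on an index set, given by words that
act on the base point `j₀`, and the lengths of the orbits. -/
structure IsOrbitTable {J : Type} (ρ : Bool → J → J) (j₀ : J) (R : List (List Bool × ℕ)) :
    Prop where
  involutive : ∀ j, ρ false (ρ false j) = j
  nodup : R.Nodup
  cover : ∀ j, ∃ e ∈ R, ∃ n < e.2, (ρ true)^[n] (moveIndex ρ e.1 j₀) = j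
  disjoint : ∀ e ∈ R, ∀ e' ∈ R, ∀ n < e.2,
    (ρ true)^[n] (moveIndex ρ e.1 j₀) = moveIndex ρ e'.1 j₀ → e = e' ∧ n = 0
  periodic : ∀ e ∈ R, 0 < e.2 ∧
    (ρ true)^[e.2] (moveIndex ρ e.1 j₀) = moveIndex ρ e.1 j₀

lemma isCuspTable_of_representatives {Γ : Subgroup SL(2, ℤ)} {L : List (OnePoint ℝ × ℕ)}
    (h_nodup : L.Nodup)
    (h_cusp : ∀ e ∈ L, IsCusp e.1 (Γ : Subgroup (GL (Fin 2) ℝ)))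
    (h_exists : ∀ x, IsCusp x (Γ : Subgroup (GL (Fin 2) ℝ)) →
      ∃ e ∈ L, ∃ γ ∈ (Γ : Subgroup (GL (Fin 2) ℝ)), γ • e.1 = x)
    (h_unique : ∀ e ∈ L, ∀ e' ∈ L, ∀ γ ∈ (Γ : Subgroup (GL (Fin 2) ℝ)), γ • e.1 = e'.1 → e = e')
    (h_width : ∀ e ∈ L, ∀ g, cuspOf g = e.1 →
      IsLeast {n : ℕ | 0 < n ∧ (g * T ^ n * g⁻¹ ∈ Γ ∨ -(g * T ^ n * g⁻¹) ∈ Γ)} e.2) :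
    IsCuspTable Γ L where
  card_eq := by
    classical
    let orbit (e : L.toFinset) : CuspOrbits (Γ : Subgroup (GL (Fin 2) ℝ)) :=
      Quotient.mk _ ⟨e.1.1, h_cusp _ (List.mem_toFinset.1 e.2)⟩
    have h_bij : Function.Bijective orbit := by
      constructor
      · rintro ⟨e, he⟩ ⟨e', he'⟩ h
        obtain ⟨γ, hγ⟩ := Quotient.exact h
        exact (Subtype.ext (h_unique e' (List.mem_toFinset.1 he') e (List.mem_toFinset.1 he) γ.1
          γ.2 (congrArg Subtype.val hγ))).symm
      · rintro ⟨x, hx⟩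
        obtain ⟨e, he, γ, hγ, h⟩ := h_exists x hx
        exact ⟨⟨e, List.mem_toFinset.2 he⟩, (Quotient.sound
          (s := MulAction.orbitRel _ (cuspsSubMulAction _)) ⟨⟨γ, hγ⟩, Subtype.ext h⟩).symm⟩
    rw [← Nat.card_congr (.ofBijective orbit h_bij), Nat.card_eq_finsetCard,
      List.toFinset_card_of_nodup h_nodup]
  isCusp := h_cusp
  existsUnique x hx := by
    obtain ⟨e, he, γ, hγ, h⟩ := h_exists x hx
    refine ⟨e, ⟨he, γ, hγ, h⟩, ?_⟩
    rintro e' ⟨he', γ', hγ', h'⟩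
    exact h_unique e' he' e he (γ⁻¹ * γ') (mul_mem (inv_mem hγ) hγ')
      (by rw [mul_smul, h', ← h, inv_smul_smul])
  width := h_width

namespace IsOrbitTable

variable {J : Type} {Γ : Subgroup SL(2, ℤ)} {c : SL(2, ℤ) → J} {ρ : Bool → J → J}
  {R : List (List Bool × ℕ)}

theorem index_eq_card (hR : IsOrbitTable ρ (c 1) R) (hc : IsCosetLabelling Γ c ρ) :
    Γ.index = Nat.card J := by
  have h_coset (A B : SL(2, ℤ)) : c A = c B ↔ QuotientGroup.leftRel Γ A B :=
    (hc.apply_eq_iff A B).trans QuotientGroup.leftRel_apply.symm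
  refine Nat.card_congr (.ofBijective
    (Quotient.lift c fun A B h => (h_coset A B).2 h) ⟨?_, fun j => ?_⟩)
  · rintro ⟨A⟩ ⟨B⟩ h
    exact Quotient.sound ((h_coset A B).1 h)
  · obtain ⟨e, -, n, -, h⟩ := hR.cover j
    refine ⟨Quotient.mk _ (T ^ n * wordMatrix e.1), ?_⟩
    rw [Quotient.lift_mk, hc.apply_T_pow_mul, hc.apply_wordMatrix, h]

lemma exists_cuspOf_eq (hR : IsOrbitTable ρ (c 1) R) (hc : IsCosetLabelling Γ c ρ)
    (g : SL(2, ℤ)) : ∃ e ∈ R, ∃ γ ∈ Γ, cuspOf (γ * (wordMatrix e.1)⁻¹) = cuspOf g := by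
  obtain ⟨e, he, n, -, hn⟩ := hR.cover (c g⁻¹)
  refine ⟨e, he, (hc.exists_cuspOf_mul_eq_iff (hc.apply_neg hR.involutive)).2 ⟨n, ?_⟩⟩
  rw [inv_inv, zpow_natCast, hc.apply_T_pow_mul, hc.apply_wordMatrix, hn]

lemma isPeriodicPt (hR : IsOrbitTable ρ (c 1) R) (hc : IsCosetLabelling Γ c ρ)
    {e : List Bool × ℕ} (he : e ∈ R) :
    Function.IsPeriodicPt (ρ true) e.2 (c (wordMatrix e.1)) := by
  rw [hc.apply_wordMatrix]
  exact (hR.periodic e he).2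

lemma eq_of_cuspOf_eq (hR : IsOrbitTable ρ (c 1) R) (hc : IsCosetLabelling Γ c ρ)
    {e e' : List Bool × ℕ} (he : e ∈ R) (he' : e' ∈ R) {γ : SL(2, ℤ)} (hγ : γ ∈ Γ)
    (h : cuspOf (γ * (wordMatrix e.1)⁻¹) = cuspOf (wordMatrix e'.1)⁻¹) : e = e' := by
  obtain ⟨k, hk⟩ :=
    (hc.exists_cuspOf_mul_eq_iff (hc.apply_neg hR.involutive)).1 ⟨γ, hγ, h⟩
  rw [inv_inv, inv_inv] at hk
  obtain ⟨n, hn, h_iterate⟩ :=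
    hc.exists_iterate_eq_of_isPeriodicPt (hR.periodic e he).1 (hR.isPeriodicPt hc he) k
  rw [← hk, hc.apply_wordMatrix, hc.apply_wordMatrix] at h_iterate
  exact (hR.disjoint e he e' he' n hn h_iterate.symm).1

lemma isLeast_width (hR : IsOrbitTable ρ (c 1) R) (hc : IsCosetLabelling Γ c ρ)
    {e : List Bool × ℕ} (he : e ∈ R) {g : SL(2, ℤ)} (hg : cuspOf g = cuspOf (wordMatrix e.1)⁻¹) :
    IsLeast {n : ℕ | 0 < n ∧ (g * T ^ n * g⁻¹ ∈ Γ ∨ -(g * T ^ n * g⁻¹) ∈ Γ)} e.2 := by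
  simp only [hc.mul_T_pow_mul_inv_mem_iff (hc.apply_neg hR.involutive) hg, inv_inv]
  refine ⟨⟨(hR.periodic e he).1, hR.isPeriodicPt hc he⟩, fun n ⟨h_pos, hn⟩ => ?_⟩
  by_contra! h_lt
  rw [hc.apply_wordMatrix] at hn
  exact h_pos.ne' (hR.disjoint e he e he n h_lt hn).2

theorem isCuspTable [Γ.FiniteIndex] (hR : IsOrbitTable ρ (c 1) R)
    (hc : IsCosetLabelling Γ c ρ) :
    IsCuspTable Γ (R.map fun e => (cuspOf (wordMatrix e.1)⁻¹, e.2)) := by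
  refine isCuspTable_of_representatives (hR.nodup.map_on fun e he e' he' h => ?_) ?_
    (fun x hx => ?_) ?_ ?_
  · exact hR.eq_of_cuspOf_eq hc he he' Γ.one_mem (by rw [one_mul]; exact congrArg Prod.fst h)
  · exact List.forall_mem_map.2 fun e _ => (isCusp_iff_exists_cuspOf_eq Γ _).2 ⟨_, rfl⟩
  · obtain ⟨g, rfl⟩ := (isCusp_iff_exists_cuspOf_eq Γ x).1 hx
    obtain ⟨e, he, γ, hγ, h⟩ := hR.exists_cuspOf_eq hc g
    exact ⟨_, List.mem_map_of_mem he, _, ⟨γ, hγ, rfl⟩, (mapGL_smul_cuspOf _ _).trans h⟩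
  · simp only [List.forall_mem_map]
    rintro e he e' he' _ ⟨γ, hγ, rfl⟩ h
    rw [hR.eq_of_cuspOf_eq hc he he' hγ ((mapGL_smul_cuspOf _ _).symm.trans h)]
  · exact List.forall_mem_map.2 fun e he g hg => hR.isLeast_width hc he hg

end IsOrbitTable

end SquareTiled

namespace SquareTiled

/-! ### Square-tiled surfaces given by tables -/

/-- The tables of the permutations `h`, `h⁻¹`, `v` and `v⁻¹` of a square-tiled surface. A table is
a natural number, with the entries as its digits in base `256`, because the kernel computes fast
with numerals. -/
structure Tables where
  h : ℕ
  hInv : ℕ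
  v : ℕ
  vInv : ℕ

namespace Tables

/-- The conjunction of `p 0`, …, `p (n - 1)`. -/
noncomputable def allBelow (p : ℕ → Bool) (n : ℕ) : Bool :=
  Nat.rec (motive := fun _ => Bool) true (fun k ih => p k && ih) n

lemma allBelow_iff (p : ℕ → Bool) (n : ℕ) : allBelow p n = true ↔ ∀ i < n, p i = true := by
  induction n with
  | zero => simp [allBelow]
  | succ n ih =>
    change (p n && allBelow p n) = true ↔ _
    rw [Bool.and_eq_true, ih, Nat.forall_lt_succ_right, and_comm]

/-- A variant of `Nat.decidableBallLT` that the kernel evaluates faster. -/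
noncomputable instance decidableForallLT (n : ℕ) (p : ℕ → Prop) [DecidablePred p] :
    Decidable (∀ i < n, p i) :=
  decidable_of_iff (allBelow (fun i => decide (p i)) n = true) (by simp [allBelow_iff])

/-- The entry at `i` of the table `c`, that is, a digit of `c` in base `256`. -/
def entry (c i : ℕ) : ℕ := c / 256 ^ i % 256

lemma entry_lt (c i : ℕ) : entry c i < 256 := Nat.mod_lt _ (by norm_num)

/-- The table of a map on `{0, …, n - 1}`. -/
noncomputable def tabulate (f : ℕ → ℕ) (n : ℕ) : ℕ :=
  Nat.rec (motive := fun _ => ℕ) 0 (fun k ih => ih + f k * 256 ^ k) n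

lemma tabulate_lt {f : ℕ → ℕ} {n : ℕ} (hf : ∀ i < n, f i < 256) : tabulate f n < 256 ^ n := by
  induction n with
  | zero => exact Nat.one_pos
  | succ n ih =>
    have h_init := ih fun i hi => hf i (by omega)
    have h_last := Nat.mul_le_mul_right (256 ^ n) (Nat.le_of_lt_succ (hf n (by omega)))
    change tabulate f n + f n * 256 ^ n < _
    rw [pow_succ]
    omega

lemma entry_tabulate {f : ℕ → ℕ} {n i : ℕ} (hf : ∀ i < n, f i < 256) (hi : i < n) :
    entry (tabulate f n) i = f i := by
  induction n with
  | zero => omega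
  | succ n ih =>
    change (tabulate f n + f n * 256 ^ n) / 256 ^ i % 256 = f i
    have hf' : ∀ i < n, f i < 256 := fun i hi => hf i (by omega)
    rcases Nat.lt_succ_iff_lt_or_eq.1 hi with h_lt | rfl
    · obtain ⟨d, rfl⟩ := Nat.exists_eq_add_of_lt h_lt
      have h_pow : f (i + d + 1) * 256 ^ (i + d + 1) =
          256 ^ i * (256 * (256 ^ d * f (i + d + 1))) := by ring
      rw [h_pow, Nat.add_mul_div_left _ _ (by positivity), Nat.add_mul_mod_self_left]
      exact ih hf' h_lt
    · rw [Nat.add_mul_div_right _ _ (by positivity), Nat.div_eq_of_lt (tabulate_lt hf'), zero_add,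
        Nat.mod_eq_of_lt (hf i hi)]

/-- The tables describe the surface `O`. -/
structure Represents {n : ℕ} (t : Tables) (O : SquareTiled (Fin n)) : Prop where
  h : ∀ i : Fin n, entry t.h i = O.h i
  hInv : ∀ i : Fin n, entry t.hInv i = (O.h⁻¹ i : Fin n)
  v : ∀ i : Fin n, entry t.v i = O.v i
  vInv : ∀ i : Fin n, entry t.vInv i = (O.v⁻¹ i : Fin n)

/-- The tables are those of a pair of permutations of `{0, …, n - 1}` and their inverses. -/
def IsValid (n : ℕ) (t : Tables) : Prop :=
  ∀ i < n, (entry t.h i < n ∧ entry t.hInv i < n ∧ entry t.v i < n ∧ entry t.vInv i < n) ∧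
    entry t.hInv (entry t.h i) = i ∧ entry t.h (entry t.hInv i) = i ∧
    entry t.vInv (entry t.v i) = i ∧ entry t.v (entry t.vInv i) = i

noncomputable instance (n : ℕ) (t : Tables) : Decidable (t.IsValid n) :=
  decidableForallLT n _

lemma IsValid.exists_represents {n : ℕ} {t : Tables} (ht : t.IsValid n) :
    ∃ O : SquareTiled (Fin n), t.Represents O := by
  choose h_lt h_left h_right v_left v_right using ht
  let h : Equiv.Perm (Fin n) :=
    ⟨fun i => ⟨entry t.h i, (h_lt i i.2).1⟩, fun i => ⟨entry t.hInv i, (h_lt i i.2).2.1⟩,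
      fun i => Fin.ext (h_left i i.2), fun i => Fin.ext (h_right i i.2)⟩
  let v : Equiv.Perm (Fin n) :=
    ⟨fun i => ⟨entry t.v i, (h_lt i i.2).2.2.1⟩, fun i => ⟨entry t.vInv i, (h_lt i i.2).2.2.2⟩,
      fun i => Fin.ext (v_left i i.2), fun i => Fin.ext (v_right i i.2)⟩
  exact ⟨⟨h, v⟩, fun _ => rfl, fun _ => rfl, fun _ => rfl, fun _ => rfl⟩

/-- The action of the generators of `SL(2, ℤ)` on tables. -/
noncomputable def move (n : ℕ) (t : Tables) : Bool → Tables
  | false => ⟨t.vInv, t.v, t.h, t.hInv⟩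
  | true => ⟨t.h, t.hInv, tabulate (fun i => entry t.v (entry t.hInv i)) n,
      tabulate (fun i => entry t.h (entry t.vInv i)) n⟩

/-- The action of a word in the generators of `SL(2, ℤ)` on tables. -/
noncomputable def moves (n : ℕ) (t : Tables) (w : List Bool) : Tables :=
  w.foldr (fun b t => t.move n b) t

/-- The square `0` is reached from every square by passing to left or lower neighbours with smaller
numbers. -/
def IsReachable (n : ℕ) (t : Tables) : Prop :=
  ∀ i < n, 0 < i → entry t.hInv i < i ∨ entry t.vInv i < i

noncomputable instance (n : ℕ) (t : Tables) : Decidable (t.IsReachable n) :=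
  decidableForallLT n _

/-- The corner of the square `i`, opposite to its lower left one, is singular. -/
def IsSingularCorner (t : Tables) (i : ℕ) : Prop :=
  entry t.h (entry t.v i) ≠ entry t.v (entry t.h i)

instance (t : Tables) (i : ℕ) : Decidable (t.IsSingularCorner i) :=
  inferInstanceAs (Decidable (_ ≠ _))

namespace Represents

variable {n : ℕ} {t : Tables} {O : SquareTiled (Fin n)}

lemma move (h : t.Represents O) (b : Bool) : (t.move n b).Represents (O.move b) := by
  cases b
  · exact ⟨h.vInv, h.v, h.h, h.hInv⟩
  · refine ⟨h.h, h.hInv, fun i => ?_, fun i => ?_⟩ <;>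
      refine (entry_tabulate (fun _ _ => entry_lt _ _) i.2).trans ?_
    · rw [h.hInv, h.v]
      rfl
    · rw [h.vInv, h.h]
      simp only [SquareTiled.move, shear, cond_true, mul_inv_rev, inv_inv, Equiv.Perm.mul_apply]

lemma moves (h : t.Represents O) (w : List Bool) : (t.moves n w).Represents (O.moves w) := by
  induction w with
  | nil => exact h
  | cons b w ih => exact ih.move b

lemma isConnected (h : t.Represents O) (ht : t.IsReachable n) : O.IsConnected := by
  intro s ⟨i₀, hi₀⟩ hs
  have h_zero (i : ℕ) (hi : i < n) : (⟨i, hi⟩ : Fin n) ∈ s ↔ (⟨0, i₀.pos⟩ : Fin n) ∈ s := by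
    induction i using Nat.strong_induction_on with
    | _ i ih =>
      rcases i.eq_zero_or_pos with rfl | h_pos
      · rfl
      · have h_step (k : Fin 2) (h_lt : ((O.side k)⁻¹ ⟨i, hi⟩ : Fin n) < i) :
            (⟨i, hi⟩ : Fin n) ∈ s ↔ (⟨0, i₀.pos⟩ : Fin n) ∈ s := by
          rw [← ih _ h_lt (Fin.is_lt _), Fin.eta, ← hs k ((O.side k)⁻¹ _), Equiv.Perm.coe_inv,
            Equiv.apply_symm_apply]
        exact (ht i hi h_pos).elim (fun h_lt => h_step 0 ((h.hInv ⟨i, hi⟩).symm.trans_lt h_lt))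
          (fun h_lt => h_step 1 ((h.vInv ⟨i, hi⟩).symm.trans_lt h_lt))
  exact Set.eq_univ_of_forall fun i => (h_zero i i.2).2 ((h_zero i₀ i₀.2).1 hi₀)

lemma isSingularCorner_iff (h : t.Represents O) (i : Fin n) :
    t.IsSingularCorner i ↔ O.IsSingularCorner i := by
  rw [IsSingularCorner, h.v, h.h, h.h, h.v]
  exact Fin.ext_iff.not.symm

lemma pow_eq_one_iff (h : t.Represents O) (p : ℕ) :
    O.h ^ p = 1 ↔ ∀ i < n, (entry t.h)^[p] i = i := by
  have h_pow (i : Fin n) : (entry t.h)^[p] i = ((O.h ^ p) i : Fin n) := by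
    rw [← Equiv.Perm.iterate_eq_pow]
    exact ((Function.Semiconj.iterate_right (f := Fin.val) fun i => (h.h i).symm) p i).symm
  simp only [Equiv.ext_iff, Fin.ext_iff, ← h_pow]
  exact Fin.forall_iff

end Represents

/-- The table `e` describes a map from the surface of `t` to the surface of `t'` that maps
neighbouring squares to neighbouring squares. -/
def IsTableMap (n : ℕ) (t t' : Tables) (e : ℕ) : Prop :=
  ∀ i < n, entry e i < n ∧ entry e (entry t.h i) = entry t'.h (entry e i) ∧
    entry e (entry t.v i) = entry t'.v (entry e i)

noncomputable instance (n : ℕ) (t t' : Tables) (e : ℕ) : Decidable (IsTableMap n t t' e) :=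
  decidableForallLT n _

lemma IsTableMap.exists_isTileMap {n : ℕ} {t t' : Tables} {e : ℕ} (he : IsTableMap n t t' e)
    {O O' : SquareTiled (Fin n)} (h : t.Represents O) (h' : t'.Represents O') :
    ∃ f : Fin n → Fin n, IsTileMap O O' f := by
  choose he_lt he_h he_v using he
  let f (i : Fin n) : Fin n := ⟨entry e i, he_lt i i.2⟩
  refine ⟨f, Fin.forall_fin_two.2 ⟨fun i => Fin.ext ?_, fun i => Fin.ext ?_⟩⟩
  · exact (congrArg (entry e) (h.h i)).symm.trans ((he_h i i.2).trans (h'.h (f i)))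
  · exact (congrArg (entry e) (h.v i)).symm.trans ((he_v i i.2).trans (h'.v (f i)))

/-- The inverse of `move`. -/
noncomputable def unmove (n : ℕ) (t : Tables) : Bool → Tables
  | false => ⟨t.v, t.vInv, t.hInv, t.h⟩
  | true => ⟨t.h, t.hInv, tabulate (fun i => entry t.v (entry t.h i)) n,
      tabulate (fun i => entry t.hInv (entry t.vInv i)) n⟩

/-- The inverse of `moves`. -/
noncomputable def unmoves (n : ℕ) (t : Tables) (w : List Bool) : Tables := w.foldl (unmove n) t

/-- The only candidate for a map from the surface of `t` to the surface of `t'` that maps the square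
`0` to `y`, if `t` is reachable: its values are computed along the paths to the square `0`. -/
noncomputable def relabelling (n : ℕ) (t t' : Tables) (y : ℕ) : ℕ :=
  Nat.rec (motive := fun _ => ℕ) y (fun i e => e +
    (if entry t.hInv (i + 1) < i + 1 then entry t'.h (entry e (entry t.hInv (i + 1)))
      else entry t'.v (entry e (entry t.vInv (i + 1)))) * 256 ^ (i + 1)) (n - 1)

/-- The surfaces obtained from the tables `t` by the words `word j` form an invariant family. The
values at the square `0` of the relabellings to be tried are listed in `bases`; `special` lists the
surfaces whose horizontal permutation has order dividing `p`, and the images under the words `test`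
that are special distinguish the surfaces. -/
structure IsInvariantFamily (n m : ℕ) (t : Tables) (word : Fin m → List Bool)
    (ρ : Bool → Fin m → Fin m) (bases : List ℕ) (p : ℕ) (special : List (Fin m))
    (test : List (List Bool)) : Prop where
  isValid : t.IsValid n
  isReachable : t.IsReachable n
  singular_h : ∃ i < n, t.IsSingularCorner i ∧ t.IsSingularCorner (entry t.h i)
  singular_v : ∃ i < n, t.IsSingularCorner i ∧ t.IsSingularCorner (entry t.v i)
  isTableMap_move : ∀ b j, ∃ y ∈ bases,
    IsTableMap n (t.moves n (word (ρ b j))) ((t.moves n (word j)).move n b)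
      (relabelling n t (((t.moves n (word j)).move n b).unmoves n (word (ρ b j))) y)
  surjective : ∀ b, Function.Surjective (ρ b)
  mem_special_iff : ∀ j, j ∈ special ↔ ∀ i < n, (entry (t.moves n (word j)).h)^[p] i = i
  eq_of_test : ∀ j k, (∀ u ∈ test, moveIndex ρ u j ∈ special ↔ moveIndex ρ u k ∈ special) → j = k

namespace IsInvariantFamily

variable {n m : ℕ} {t : Tables} {word : Fin m → List Bool} {ρ : Bool → Fin m → Fin m}
  {bases : List ℕ} {p : ℕ} {special : List (Fin m)} {test : List (List Bool)}
  {O : SquareTiled (Fin n)}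

lemma hasSingularSide (ht : IsInvariantFamily n m t word ρ bases p special test)
    (hO : t.Represents O) (k : Fin 2) : O.HasSingularSide k := by
  fin_cases k
  · obtain ⟨i, hi, h_corner, h_right⟩ := ht.singular_h
    rw [hO.h ⟨i, hi⟩] at h_right
    exact ⟨⟨i, hi⟩, (hO.isSingularCorner_iff _).1 h_corner, (hO.isSingularCorner_iff _).1 h_right⟩
  · obtain ⟨i, hi, h_corner, h_top⟩ := ht.singular_v
    rw [hO.v ⟨i, hi⟩] at h_top
    exact ⟨⟨i, hi⟩, (hO.isSingularCorner_iff _).1 h_corner, (hO.isSingularCorner_iff _).1 h_top⟩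

lemma isInvariantFamily (ht : IsInvariantFamily n m t word ρ bases p special test)
    (hO : t.Represents O) : SquareTiled.IsInvariantFamily (fun j => O.moves (word j)) ρ := by
  have h_conn := hO.isConnected ht.isReachable
  obtain ⟨i, hi, -⟩ := ht.hasSingularSide hO 0
  have : Nonempty (Fin n) := ⟨i⟩
  have h_move (b : Bool) (j : Fin m) :
      Isomorphic ((O.moves (word j)).move b) (O.moves (word (ρ b j))) := by
    obtain ⟨y, -, hy⟩ := ht.isTableMap_move b j
    obtain ⟨f, hf⟩ := hy.exists_isTileMap (hO.moves _) ((hO.moves _).move _)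
    have h_surj := hf.surjective ((h_conn.moves _).move b)
    exact (hf.isomorphic ⟨Finite.injective_iff_surjective.2 h_surj, h_surj⟩).symm
  have h_special (j : Fin m) : (O.moves (word j)).h ^ p = 1 ↔ j ∈ special := by
    rw [(hO.moves _).pow_eq_one_iff, ht.mem_special_iff]
  refine isInvariantFamily_of_moves h_conn (fun h => hi (Equiv.congr_fun h i)) word h_move
    ht.surjective p test fun j k h => ht.eq_of_test j k ?_
  simpa only [h_special] using h

theorem hasVeechData {κ : Type} (ht : IsInvariantFamily n m t word ρ bases p special test)
    {C : SquareTiled κ} (hC : ∀ O : SquareTiled (Fin n), t.Represents O → Isomorphic C O)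
    {j₀ : Fin m} (hj₀ : word j₀ = []) {R : List (List Bool × ℕ)} (hR : IsOrbitTable ρ j₀ R) :
    HasVeechData C m (R.map fun e => (cuspOf (wordMatrix e.1)⁻¹, e.2)) := by
  obtain ⟨O, hO⟩ := ht.isValid.exists_represents
  obtain ⟨i, -⟩ := ht.hasSingularSide hO 0
  have : Nonempty (Fin n) := ⟨i⟩
  have h_base : O.moves (word j₀) = O := by rw [hj₀]; rfl
  obtain ⟨Γ, hΓ, c, rfl, hc⟩ := (ht.isInvariantFamily hO).exists_isCosetLabelling
    (h_base.symm ▸ hC O hO) (h_base.symm ▸ ht.hasSingularSide hO)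
  have h_index : Γ.index = m := (hR.index_eq_card hc).trans (Nat.card_fin m)
  have : Γ.FiniteIndex := ⟨h_index.trans_ne (c 1).pos.ne'⟩
  exact ⟨Γ, hΓ, this, h_index, hR.isCuspTable hc⟩

end IsInvariantFamily

end Tables

/-! ### Components of the unfolding -/

section Component

variable {ι κ X : Type} (O : SquareTiled ι)

lemma apply_eq_of_mem_tiles {i j : ι} {g : ι → X} (hg : ∀ k i, g (O.side k i) = g i)
    (hj : j ∈ O.tiles i) : g j = g i := by
  obtain ⟨⟨s, hs⟩, rfl⟩ := hj
  change g (s i) = g i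
  induction hs using Subgroup.closure_induction generalizing i with
  | mem s hs =>
    rcases hs with rfl | rfl
    · exact hg 0 i
    · exact hg 1 i
  | one => rfl
  | mul s s' _ _ h h' => exact (h (i := s' i)).trans h'
  | inv s _ h => exact (h (i := s⁻¹ i)).symm.trans (congrArg g (s.apply_symm_apply i))

lemma isomorphic_component {O' : SquareTiled κ} {e : ι → κ} (he : IsTileMap O O' e) {i₀ : ι}
    (h_inj : Set.InjOn e (O.tiles i₀)) (hO' : O'.IsConnected) :
    Isomorphic (O.component i₀) O' := by
  have : Nonempty (O.tiles i₀) := ⟨⟨i₀, MulAction.mem_orbit_self i₀⟩⟩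
  have he' : IsTileMap (O.component i₀) O' ((O.tiles i₀).domRestrict e) :=
    Fin.forall_fin_two.2 ⟨fun i => he 0 i, fun i => he 1 i⟩
  exact he'.isomorphic ⟨h_inj.injective, he'.surjective hO'⟩

end Component

namespace Tables

/-- The table with the entries of a list. -/
noncomputable def ofList (l : List ℕ) : ℕ :=
  List.rec (motive := fun _ => ℕ) 0 (fun x _ ih => x + 256 * ih) l

/-- The table of the inverse of an injective map on `{0, …, n - 1}`. -/
noncomputable def inverse (c n : ℕ) : ℕ :=
  Nat.rec (motive := fun _ => ℕ) 0 (fun k ih => ih + k * 256 ^ entry c k) n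

/-- The tables of a surface with horizontal cylinders of length `k`, numbered consecutively, with
the given vertical permutation. -/
noncomputable def ofCylinders (n k : ℕ) (v : List ℕ) : Tables where
  h := tabulate (fun i => i - i % k + (i % k + 1) % k) n
  hInv := tabulate (fun i => i - i % k + (i % k + (k - 1)) % k) n
  v := ofList v
  vInv := inverse (ofList v) n

end Tables

open Tables (entry)

variable {D : Type} {n : ℕ} {t : Tables} {O' : SquareTiled (Fin n)}

/-- The table `labels` numbers the squares of `O`, in the order given by `E`, such that the `a`-th
component consists of the squares with the numbers `a * n + i`, where `i < n` is the corresponding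
square of the tables `t`. -/
structure IsLabelling (O : SquareTiled D) (n : ℕ) (t : Tables) {r : ℕ} (E : D ≃ Fin r)
    (labels : ℕ) : Prop where
  inverse : ∀ i < r, entry (Tables.inverse labels r) (entry labels i) = i
  right : ∀ d, entry labels (E (O.h d)) =
    entry labels (E d) / n * n + entry t.h (entry labels (E d) % n)
  top : ∀ d, entry labels (E (O.v d)) =
    entry labels (E d) / n * n + entry t.v (entry labels (E d) % n)

namespace IsLabelling

lemma isomorphic [NeZero n] {Θ : Type} {O : SquareTiled D} {r : ℕ} {E : D ≃ Fin r} {labels : ℕ}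
    (h : IsLabelling O n t E labels) (ht : t.IsReachable n) (hO' : t.Represents O')
    {U : SquareTiled (D × Θ)} (hU : ∀ k x, U.side k x = (O.side k x.1, x.2)) (x₀ : D × Θ) :
    Isomorphic (U.component x₀) O' := by
  let label (x : D × Θ) : ℕ := entry labels (E x.1)
  let e (x : D × Θ) : Fin n := Fin.ofNat n (label x)
  have h_label (k x) : label (U.side k x) = label x / n * n + (O'.side k (e x) : Fin n) := by
    revert k
    simp only [label, hU]
    exact Fin.forall_fin_two.2
      ⟨(h.right x.1).trans (congrArg _ (hO'.h (e x))), (h.top x.1).trans (congrArg _ (hO'.v (e x)))⟩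
  have he : IsTileMap U O' e := fun k x => Fin.ext <| by
    rw [Fin.val_ofNat, h_label, Nat.mul_add_mod_of_lt (Fin.is_lt _)]
  have h_sheet (k x) : (label (U.side k x) / n, (U.side k x).2) = (label x / n, x.2) := by
    rw [h_label, hU, mul_comm, Nat.mul_add_div (NeZero.pos n), Nat.div_eq_of_lt (Fin.is_lt _),
      add_zero]
  refine U.isomorphic_component he (fun x hx y hy hxy => ?_) (hO'.isConnected ht)
  have h_sheet_eq := (U.apply_eq_of_mem_tiles (g := fun x => (label x / n, x.2)) h_sheet hx).trans
    (U.apply_eq_of_mem_tiles (g := fun x => (label x / n, x.2)) h_sheet hy).symm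
  rw [Prod.mk.injEq] at h_sheet_eq
  have h_label_eq : label x = label y := by
    rw [← Nat.div_add_mod (label x) n, ← Nat.div_add_mod (label y) n, h_sheet_eq.1]
    exact congrArg _ (Fin.ext_iff.1 hxy)
  refine Prod.ext (E.injective (Fin.ext ?_)) h_sheet_eq.2
  rw [← h.inverse _ (E x.1).2, ← h.inverse _ (E y.1).2]
  exact congrArg _ h_label_eq

variable {M : DartMap D} {r : ℕ} {E : D ≃ Fin r} {labels : ℕ}

/- In the following three lemmas, the turns on the way from a square or rhombus to a neighbour add
up to a multiple of `2 * π`. -/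

lemma isomorphic_squareCover [NeZero n] (h : IsLabelling M.squares n t E labels)
    (ht : t.IsReachable n) (hO' : t.Represents O') (d : D) :
    Isomorphic (squareCover M d) O' := by
  have h_right : ∀ θ : ZMod 4, θ + ((4 / 4 : ℕ) : ZMod 4) + ((4 / 2 : ℕ) : ZMod 4) +
      ((4 / 4 : ℕ) : ZMod 4) = θ := by decide
  have h_top : ∀ θ : ZMod 4, θ + ((4 / 4 : ℕ) : ZMod 4) + ((4 / 4 : ℕ) : ZMod 4) +
      ((4 / 2 : ℕ) : ZMod 4) = θ := by decide
  exact h.isomorphic ht hO' (U := (M.unfold 4 4).squares) (Fin.forall_fin_two.2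
    ⟨fun x => Prod.ext rfl (h_right x.2), fun x => Prod.ext rfl (h_top x.2)⟩) _

lemma isomorphic_rhombusCover60 [NeZero n] (h : IsLabelling M.rhombi60 n t E labels)
    (ht : t.IsReachable n) (hO' : t.Represents O') (d : D) :
    Isomorphic (rhombusCover60 M d) O' := by
  have h_right : ∀ θ : ZMod 6, θ + ((6 / 3 : ℕ) : ZMod 6) + ((6 / 2 : ℕ) : ZMod 6) +
      ((6 / 3 : ℕ) : ZMod 6) + ((6 / 2 : ℕ) : ZMod 6) + ((6 / 3 : ℕ) : ZMod 6) = θ := by decide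
  have h_top : ∀ θ : ZMod 6, θ + ((6 / 3 : ℕ) : ZMod 6) + ((6 / 2 : ℕ) : ZMod 6) +
      ((6 / 3 : ℕ) : ZMod 6) + ((6 / 3 : ℕ) : ZMod 6) + ((6 / 2 : ℕ) : ZMod 6) = θ := by decide
  exact h.isomorphic ht hO' (U := (M.unfold 6 3).rhombi60) (Fin.forall_fin_two.2
    ⟨fun x => Prod.ext rfl (h_right x.2), fun x => Prod.ext rfl (h_top x.2)⟩) _

lemma isomorphic_rhombusCover120 [NeZero n] (h : IsLabelling M.rhombi120 n t E labels)
    (ht : t.IsReachable n) (hO' : t.Represents O') (d : D) :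
    Isomorphic (rhombusCover120 M d) O' := by
  have h_right : ∀ θ : ZMod 6, θ + ((6 / 3 : ℕ) : ZMod 6) + ((6 / 2 : ℕ) : ZMod 6) +
      ((6 / 3 : ℕ) : ZMod 6) + ((6 / 2 : ℕ) : ZMod 6) + ((6 / 3 : ℕ) : ZMod 6) = θ := by decide
  have h_top : ∀ θ : ZMod 6, θ + ((6 / 3 : ℕ) : ZMod 6) + ((6 / 3 : ℕ) : ZMod 6) +
      ((6 / 2 : ℕ) : ZMod 6) + ((6 / 3 : ℕ) : ZMod 6) + ((6 / 2 : ℕ) : ZMod 6) = θ := by decide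
  exact h.isomorphic ht hO' (U := (M.unfold 6 3).rhombi120) (Fin.forall_fin_two.2
    ⟨fun x => Prod.ext rfl (h_right x.2), fun x => Prod.ext rfl (h_top x.2)⟩) _

end IsLabelling

lemma cuspOf_eq_coe {g : SL(2, ℤ)} {a b : ℤ} (hg : g.1.col 0 = ![a, b]) (hb : b ≠ 0) {x : ℝ}
    (hx : a / b = x) : cuspOf g = (x : OnePoint ℝ) := by
  have h_upper : (Matrix.SpecialLinearGroup.mapGL ℝ g) 0 0 = (a : ℝ) :=
    congrArg Int.cast (congrFun hg 0)
  have h_lower : (Matrix.SpecialLinearGroup.mapGL ℝ g) 1 0 = (b : ℝ) :=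
    congrArg Int.cast (congrFun hg 1)
  rw [cuspOf, OnePoint.smul_infty_eq_ite, h_upper, h_lower, if_neg (by exact_mod_cast hb), hx]

lemma cuspOf_wordMatrix_nil_inv : cuspOf (wordMatrix [])⁻¹ = OnePoint.infty := by
  simp [cuspOf, wordMatrix]

/-! ### The five surfaces -/

namespace MucubeCover

/-- The tables of a square-tiled surface isomorphic to every component of the translation cover of
Mucube. -/
noncomputable def tables : Tables := .ofCylinders 24 4 [
    4, 8, 12, 16, 20, 9, 2, 19, 23, 13, 3, 7, 22, 17, 0, 11, 21, 5, 1, 15, 14, 10, 6, 18]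

/-- The numbering of the squares of the unfolding of Mucube in the sense of `IsLabelling`. -/
noncomputable def labels : ℕ := Tables.ofList [
    0, 24, 22, 46, 44, 20, 26, 2, 47, 14, 27, 6, 4, 25, 12, 45, 38, 21, 30, 1, 3, 28, 23, 36, 10,
    31, 18, 37, 39, 16, 29, 8, 5, 42, 15, 34, 32, 13, 40, 7, 35, 17, 41, 11, 9, 43, 19, 33]

lemma isLabelling : IsLabelling (DartMap.squares mucube.toDartMap) 24 tables
    finProdFinEquiv labels where
  inverse := by decide +kernel
  right := by decide +kernel
  top := by decide +kernel

/-- Words in the generators that map `tables` to the elements of its orbit under `SL(2, ℤ)`. -/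
def word : Fin 9 → List Bool := ![
    [], [true], [true, true], [false, true], [true, true, true], [false, true, true],
    [true, false, true], [true, false, true, true], [true, true, false, true]]

/-- The action of `S` and `T` on the orbit. -/
def ρ : Bool → Fin 9 → Fin 9
  | false => ![0, 3, 5, 1, 6, 2, 4, 8, 7]
  | true => ![1, 2, 4, 6, 0, 7, 8, 5, 3]

lemma isInvariantFamily : Tables.IsInvariantFamily 24 9 tables word ρ [0] 2 [5, 7] [
      [], [false, true, true, true, false], [false], [false, true, true, true], [false, true],
      [false, true, false]] where
  isValid := by decide +kernel
  isReachable := by decide +kernel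
  singular_h := by decide +kernel
  singular_v := by decide +kernel
  isTableMap_move := by decide +kernel
  surjective := by decide +kernel
  mem_special_iff := by decide +kernel
  eq_of_test := by decide +kernel

lemma isOrbitTable : IsOrbitTable ρ 0 [
    ([], 4), ([false, true, true, false], 2), ([false, true, false], 3)] where
  involutive := by decide +kernel
  nodup := by decide +kernel
  cover := by decide +kernel
  disjoint := by decide +kernel
  periodic := by decide +kernel

theorem hasVeechData (d : Fin 12 × Fin 4) :
    HasVeechData (squareCover mucube.toDartMap d) 9
      [(OnePoint.infty, 4), (((1 / 2 : ℝ) : OnePoint ℝ), 2), (((1 : ℝ) : OnePoint ℝ), 3)] := by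
  have h_half : cuspOf (wordMatrix [false, true, true, false])⁻¹ = ((1 / 2 : ℝ) : OnePoint ℝ) :=
    cuspOf_eq_coe (a := -1) (b := -2) (by decide +kernel) (by norm_num) (by norm_num)
  have h_one : cuspOf (wordMatrix [false, true, false])⁻¹ = ((1 : ℝ) : OnePoint ℝ) :=
    cuspOf_eq_coe (a := -1) (b := -1) (by decide +kernel) (by norm_num) (by norm_num)
  simpa only [List.map_cons, List.map_nil, cuspOf_wordMatrix_nil_inv, h_half, h_one] using
    isInvariantFamily.hasVeechData (j₀ := 0) (fun _ hO =>
      isLabelling.isomorphic_squareCover isInvariantFamily.isReachable hO d) rfl isOrbitTable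

end MucubeCover

namespace MuoctahedronCover

/-- The tables of a square-tiled surface isomorphic to every component of the translation cover of
Muoctahedron. -/
noncomputable def tables : Tables := .ofCylinders 72 9 [
    9, 10, 18, 15, 16, 27, 12, 13, 36, 2, 45, 7, 8, 54, 4, 5, 63, 1, 58, 59, 30, 55, 56, 6, 61,
    62, 42, 49, 50, 39, 46, 47, 0, 52, 53, 24, 67, 68, 21, 64, 65, 3, 70, 71, 33, 31, 32, 57, 28,
    29, 14, 34, 35, 69, 22, 23, 66, 19, 20, 17, 25, 26, 51, 40, 41, 48, 37, 38, 11, 43, 44, 60]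

/-- The numbering of the squares of the unfolding of Muoctahedron in the sense of `IsLabelling`. -/
noncomputable def labels : ℕ := Tables.ofList [
    0, 64, 62, 72, 136, 134, 39, 61, 10, 111, 133, 82, 24, 9, 65, 96, 81, 137, 54, 31, 41, 132,
    79, 101, 45, 40, 23, 83, 100, 98, 63, 22, 32, 120, 97, 80, 51, 1, 38, 126, 103, 113, 17, 37,
    35, 117, 112, 95, 66, 34, 2, 135, 94, 104, 33, 15, 56, 78, 118, 143, 3, 55, 53, 102, 142, 85,
    21, 52, 16, 114, 84, 119, 60, 7, 29, 123, 73, 110, 11, 28, 26, 89, 109, 107, 48, 25, 8, 138,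
    106, 74, 6, 46, 71, 90, 139, 122, 30, 70, 13, 108, 121, 131, 42, 12, 47, 99, 130, 140, 18,
    67, 50, 105, 87, 128, 36, 49, 59, 75, 127, 125, 27, 58, 68, 93, 124, 88, 57, 43, 5, 141, 76,
    92, 69, 4, 20, 86, 91, 116, 14, 19, 44, 129, 115, 77]

lemma isLabelling : IsLabelling (DartMap.rhombi120 muoctahedron.toDartMap.subdivide) 72 tables
    ((finProdFinEquiv.prodCongr (Equiv.refl (Fin 3))).trans finProdFinEquiv) labels where
  inverse := by decide +kernel
  right := by decide +kernel
  top := by decide +kernel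

/-- Words in the generators that map `tables` to the elements of its orbit under `SL(2, ℤ)`. -/
def word : Fin 16 → List Bool := ![
    [], [true], [false], [true, true], [false, true], [true, true, true], [false, true, true],
    [true, false, true], [true, true, true, true], [false, true, true, true],
    [true, false, true, true], [true, true, false, true], [false, true, false, true],
    [false, true, true, true, true], [true, false, true, true, true],
    [true, true, false, true, true]]

/-- The action of `S` and `T` on the orbit. -/
def ρ : Bool → Fin 16 → Fin 16
  | false => ![2, 4, 0, 6, 1, 9, 3, 12, 13, 5, 11, 10, 7, 8, 15, 14]
  | true => ![1, 3, 0, 5, 7, 8, 10, 11, 9, 14, 15, 4, 2, 13, 12, 6]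

lemma isInvariantFamily : Tables.IsInvariantFamily 72 16 tables word ρ [0, 1, 2] 6
    [4, 6, 7, 10, 11, 13, 15] [
      [], [false], [false, true, true, true, false, true], [false, true, true],
      [false, true, true, false], [false, true, true, true, true]] where
  isValid := by decide +kernel
  isReachable := by decide +kernel
  singular_h := by decide +kernel
  singular_v := by decide +kernel
  isTableMap_move := by decide +kernel
  surjective := by decide +kernel
  mem_special_iff := by decide +kernel
  eq_of_test := by decide +kernel

lemma isOrbitTable : IsOrbitTable ρ 0 [
    ([], 9), ([false, true, true, true, true, true, false], 1), ([false, true, true, false], 3),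
    ([false, true, true, true, true, true, true, true, false], 3)] where
  involutive := by decide +kernel
  nodup := by decide +kernel
  cover := by decide +kernel
  disjoint := by decide +kernel
  periodic := by decide +kernel

theorem hasVeechData (d : (Fin 8 × Fin 6) × Fin 3) :
    HasVeechData (rhombusCover120 muoctahedron.toDartMap.subdivide d) 16
      [(OnePoint.infty, 9), (((1 / 5 : ℝ) : OnePoint ℝ), 1), (((1 / 2 : ℝ) : OnePoint ℝ), 3),
        (((1 / 7 : ℝ) : OnePoint ℝ), 3)] := by
  have h_fifth : cuspOf (wordMatrix [false, true, true, true, true, true, false])⁻¹ =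
      ((1 / 5 : ℝ) : OnePoint ℝ) :=
    cuspOf_eq_coe (a := -1) (b := -5) (by decide +kernel) (by norm_num) (by norm_num)
  have h_half : cuspOf (wordMatrix [false, true, true, false])⁻¹ = ((1 / 2 : ℝ) : OnePoint ℝ) :=
    cuspOf_eq_coe (a := -1) (b := -2) (by decide +kernel) (by norm_num) (by norm_num)
  have h_seventh : cuspOf (wordMatrix [false, true, true, true, true, true, true, true, false])⁻¹ =
      ((1 / 7 : ℝ) : OnePoint ℝ) :=
    cuspOf_eq_coe (a := -1) (b := -7) (by decide +kernel) (by norm_num) (by norm_num)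
  simpa only [List.map_cons, List.map_nil, cuspOf_wordMatrix_nil_inv, h_fifth, h_half,
    h_seventh] using
    isInvariantFamily.hasVeechData (j₀ := 0) (fun _ hO =>
      isLabelling.isomorphic_rhombusCover120 isInvariantFamily.isReachable hO d) rfl isOrbitTable

end MuoctahedronCover

namespace MutetrahedronCover

/-- The tables of a square-tiled surface isomorphic to every component of the translation cover of
Mutetrahedron. -/
noncomputable def tables : Tables := .ofCylinders 24 6 [
    6, 12, 8, 9, 15, 11, 4, 5, 18, 1, 2, 21, 23, 0, 19, 20, 3, 22, 17, 7, 13, 14, 10, 16]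

/-- The numbering of the squares of the unfolding of Mutetrahedron in the sense of `IsLabelling`. -/
noncomputable def labels : ℕ := Tables.ofList [
    0, 37, 53, 60, 16, 33, 45, 52, 6, 18, 32, 71, 55, 11, 38, 27, 70, 17, 24, 56, 5, 12, 40, 62,
    51, 4, 30, 42, 61, 23, 7, 35, 57, 69, 22, 41, 3, 28, 65, 48, 13, 47, 31, 64, 9, 21, 46, 54,
    66, 8, 29, 36, 59, 14, 39, 67, 2, 15, 25, 50, 63, 1, 44, 34, 49, 20, 10, 43, 68, 58, 19, 26]

lemma isLabelling : IsLabelling (DartMap.rhombi60 mutetrahedron.toDartMap.subdivide) 24 tables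
    ((finProdFinEquiv.prodCongr (Equiv.refl (Fin 3))).trans finProdFinEquiv) labels where
  inverse := by decide +kernel
  right := by decide +kernel
  top := by decide +kernel

/-- Words in the generators that map `tables` to the elements of its orbit under `SL(2, ℤ)`. -/
def word : Fin 4 → List Bool :=
  ![[], [true], [true, true], [false, true, true]]

/-- The action of `S` and `T` on the orbit. -/
def ρ : Bool → Fin 4 → Fin 4
  | false => ![1, 0, 3, 2]
  | true => ![1, 2, 0, 3]

lemma isInvariantFamily : Tables.IsInvariantFamily 24 4 tables word ρ [0, 1, 2] 2 [3] [
      [], [false], [false, true]] where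
  isValid := by decide +kernel
  isReachable := by decide +kernel
  singular_h := by decide +kernel
  singular_v := by decide +kernel
  isTableMap_move := by decide +kernel
  surjective := by decide +kernel
  mem_special_iff := by decide +kernel
  eq_of_test := by decide +kernel

lemma isOrbitTable : IsOrbitTable ρ 0 [([], 3), ([false, true, false], 1)] where
  involutive := by decide +kernel
  nodup := by decide +kernel
  cover := by decide +kernel
  disjoint := by decide +kernel
  periodic := by decide +kernel

theorem hasVeechData (d : (Fin 4 × Fin 6) × Fin 3) :
    HasVeechData (rhombusCover60 mutetrahedron.toDartMap.subdivide d) 4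
      [(OnePoint.infty, 3), (((1 : ℝ) : OnePoint ℝ), 1)] := by
  have h_one : cuspOf (wordMatrix [false, true, false])⁻¹ = ((1 : ℝ) : OnePoint ℝ) :=
    cuspOf_eq_coe (a := -1) (b := -1) (by decide +kernel) (by norm_num) (by norm_num)
  simpa only [List.map_cons, List.map_nil, cuspOf_wordMatrix_nil_inv, h_one] using
    isInvariantFamily.hasVeechData (j₀ := 0) (fun _ hO =>
      isLabelling.isomorphic_rhombusCover60 isInvariantFamily.isReachable hO d) rfl isOrbitTable

end MutetrahedronCover

namespace Octa4Cover

/-- The tables of a square-tiled surface isomorphic to every component of the translation cover of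
Octa-4. -/
noncomputable def tables : Tables := .ofCylinders 48 3 [
    3, 6, 9, 12, 15, 18, 21, 14, 24, 16, 23, 27, 0, 30, 33, 36, 2, 39, 31, 38, 22, 1, 42, 45, 43,
    35, 17, 40, 47, 13, 29, 5, 44, 7, 28, 37, 4, 25, 46, 26, 11, 32, 20, 8, 41, 10, 19, 34]

/-- The numbering of the squares of the unfolding of Octa-4 in the sense of `IsLabelling`. -/
noncomputable def labels : ℕ := Tables.ofList [
    0, 46, 41, 9, 35, 31, 7, 18, 11, 48, 94, 89, 5, 10, 24, 93, 74, 60, 91, 51, 95, 87, 62, 67,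
    82, 92, 50, 20, 16, 33, 38, 40, 6, 32, 1, 37, 68, 64, 81, 21, 36, 29, 63, 76, 90, 61, 70, 65,
    53, 58, 72, 25, 30, 23, 43, 3, 47, 15, 28, 42, 75, 56, 52, 34, 44, 2, 55, 66, 59, 86, 88, 54,
    27, 8, 4, 13, 22, 17, 45, 26, 12, 73, 78, 71, 39, 14, 19, 80, 49, 85, 57, 83, 79, 69, 84, 77]

lemma isLabelling : IsLabelling (DartMap.rhombi120 octa4.toDartMap) 48 tables
    finProdFinEquiv labels where
  inverse := by decide +kernel
  right := by decide +kernel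
  top := by decide +kernel

/-- Words in the generators that map `tables` to the elements of its orbit under `SL(2, ℤ)`. -/
def word : Fin 4 → List Bool :=
  ![[], [true], [false], [false, true]]

/-- The action of `S` and `T` on the orbit. -/
def ρ : Bool → Fin 4 → Fin 4
  | false => ![2, 3, 0, 1]
  | true => ![1, 2, 0, 3]

lemma isInvariantFamily : Tables.IsInvariantFamily 48 4 tables word ρ [0] 3 [0, 1, 2] [
      [], [false], [false, true]] where
  isValid := by decide +kernel
  isReachable := by decide +kernel
  singular_h := by decide +kernel
  singular_v := by decide +kernel
  isTableMap_move := by decide +kernel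
  surjective := by decide +kernel
  mem_special_iff := by decide +kernel
  eq_of_test := by decide +kernel

lemma isOrbitTable : IsOrbitTable ρ 0 [([], 3), ([false, true, true, false], 1)] where
  involutive := by decide +kernel
  nodup := by decide +kernel
  cover := by decide +kernel
  disjoint := by decide +kernel
  periodic := by decide +kernel

theorem hasVeechData (d : Fin 32 × Fin 3) :
    HasVeechData (rhombusCover120 octa4.toDartMap d) 4
      [(OnePoint.infty, 3), (((1 / 2 : ℝ) : OnePoint ℝ), 1)] := by
  have h_half : cuspOf (wordMatrix [false, true, true, false])⁻¹ = ((1 / 2 : ℝ) : OnePoint ℝ) :=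
    cuspOf_eq_coe (a := -1) (b := -2) (by decide +kernel) (by norm_num) (by norm_num)
  simpa only [List.map_cons, List.map_nil, cuspOf_wordMatrix_nil_inv, h_half] using
    isInvariantFamily.hasVeechData (j₀ := 0) (fun _ hO =>
      isLabelling.isomorphic_rhombusCover120 isInvariantFamily.isReachable hO d) rfl isOrbitTable

end Octa4Cover

namespace TruncatedOcta8Cover

/-- The tables of a square-tiled surface isomorphic to every component of the translation cover of
Truncated Octa-8. -/
noncomputable def tables : Tables := .ofCylinders 120 6 [
    6, 12, 18, 24, 30, 36, 42, 20, 48, 3, 54, 34, 60, 26, 66, 4, 53, 40, 72, 32, 78, 5, 71, 10,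
    84, 38, 90, 0, 83, 16, 96, 8, 102, 1, 95, 22, 108, 14, 55, 2, 107, 28, 114, 50, 73, 9, 101,
    58, 62, 56, 13, 11, 70, 46, 112, 44, 103, 7, 41, 52, 119, 68, 85, 15, 113, 51, 74, 49, 19,
    17, 82, 64, 118, 80, 97, 21, 47, 69, 86, 67, 25, 23, 94, 76, 117, 92, 109, 27, 65, 81, 98,
    79, 31, 29, 106, 88, 116, 104, 43, 33, 77, 93, 110, 91, 37, 35, 59, 100, 115, 57, 61, 39, 89,
    105, 87, 75, 63, 45, 111, 99]

/-- The numbering of the squares of the unfolding of Truncated Octa-8 in the sense of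
`IsLabelling`. -/
noncomputable def labels : ℕ := Tables.ofList [
    0, 103, 117, 70, 1, 56, 116, 82, 2, 49, 115, 94, 3, 67, 114, 106, 4, 79, 119, 59, 5, 91, 118,
    52, 46, 22, 26, 110, 47, 35, 25, 61, 42, 105, 24, 68, 43, 113, 29, 19, 44, 64, 28, 32, 45,
    71, 27, 102, 96, 81, 12, 57, 97, 89, 17, 7, 98, 112, 16, 20, 99, 54, 15, 78, 100, 10, 14, 86,
    101, 23, 13, 109, 36, 92, 72, 51, 37, 85, 77, 11, 38, 62, 76, 34, 39, 48, 75, 95, 40, 8, 74,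
    88, 41, 31, 73, 65, 111, 53, 21, 90, 50, 108, 93, 18, 63, 83, 33, 55, 60, 58, 30, 80, 107, 9,
    66, 87, 6, 104, 84, 69]

lemma isLabelling : IsLabelling (DartMap.squares truncatedOcta8.toDartMap) 120 tables
    finProdFinEquiv labels where
  inverse := by decide +kernel
  right := by decide +kernel
  top := by decide +kernel

/-- Words in the generators that map `tables` to the elements of its orbit under `SL(2, ℤ)`. -/
def word : Fin 15 → List Bool := ![
    [], [true], [true, true], [false, true], [true, true, true], [false, true, true],
    [true, false, true], [true, true, true, true], [false, true, true, true],
    [true, false, true, true], [true, true, false, true], [false, true, false, true],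
    [false, true, true, true, true], [true, false, true, true, true],
    [true, false, true, true, true, true]]

/-- The action of `S` and `T` on the orbit. -/
def ρ : Bool → Fin 15 → Fin 15
  | false => ![0, 3, 5, 1, 8, 2, 11, 12, 4, 10, 9, 6, 7, 14, 13]
  | true => ![1, 2, 4, 6, 7, 9, 10, 11, 13, 12, 3, 0, 14, 8, 5]

lemma isInvariantFamily : Tables.IsInvariantFamily 120 15 tables word ρ [0] 3 [3, 6, 10] [
      [], [false, true, true, false], [false, true, true, true, true, false, true], [false],
      [false, true, true], [false, true, true, true, true, true, true], [false, true],
      [false, true, true, true, false], [false, true, true, true]] where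
  isValid := by decide +kernel
  isReachable := by decide +kernel
  singular_h := by decide +kernel
  singular_v := by decide +kernel
  isTableMap_move := by decide +kernel
  surjective := by decide +kernel
  mem_special_iff := by decide +kernel
  eq_of_test := by decide +kernel

lemma isOrbitTable : IsOrbitTable ρ 0 [
    ([], 6), ([false, true, true, false, true, true, false, true, false], 2),
    ([false, true, false], 3),
    ([false, true, true, false, true, true, false, true, true, false, true, false], 4)] where
  involutive := by decide +kernel
  nodup := by decide +kernel
  cover := by decide +kernel
  disjoint := by decide +kernel
  periodic := by decide +kernel

theorem hasVeechData (d : Fin 30 × Fin 4) :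
    HasVeechData (squareCover truncatedOcta8.toDartMap d) 15
      [(OnePoint.infty, 6), (((3 : ℝ) : OnePoint ℝ), 2), (((1 : ℝ) : OnePoint ℝ), 3),
        (((4 : ℝ) : OnePoint ℝ), 4)] := by
  have h_three : cuspOf (wordMatrix [false, true, true, false, true, true, false, true, false])⁻¹ =
      ((3 : ℝ) : OnePoint ℝ) :=
    cuspOf_eq_coe (a := -3) (b := -1) (by decide +kernel) (by norm_num) (by norm_num)
  have h_one : cuspOf (wordMatrix [false, true, false])⁻¹ = ((1 : ℝ) : OnePoint ℝ) :=
    cuspOf_eq_coe (a := -1) (b := -1) (by decide +kernel) (by norm_num) (by norm_num)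
  have h_four : cuspOf (wordMatrix [false, true, true, false, true, true, false, true, true, false,
      true, false])⁻¹ = ((4 : ℝ) : OnePoint ℝ) :=
    cuspOf_eq_coe (a := -4) (b := -1) (by decide +kernel) (by norm_num) (by norm_num)
  simpa only [List.map_cons, List.map_nil, cuspOf_wordMatrix_nil_inv, h_three, h_one, h_four] using
    isInvariantFamily.hasVeechData (j₀ := 0) (fun _ hO =>
      isLabelling.isomorphic_squareCover isInvariantFamily.isReachable hO d) rfl isOrbitTable

end TruncatedOcta8Cover

end SquareTiled

theorem mainTheorem2 :
    (∀ d, HasVeechData (squareCover mucube.toDartMap d) 9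
      [(OnePoint.infty, 4), (((1 / 2 : ℝ) : OnePoint ℝ), 2), (((1 : ℝ) : OnePoint ℝ), 3)]) ∧
    (∀ d, HasVeechData (rhombusCover120 muoctahedron.toDartMap.subdivide d) 16
      [(OnePoint.infty, 9), (((1 / 5 : ℝ) : OnePoint ℝ), 1), (((1 / 2 : ℝ) : OnePoint ℝ), 3),
        (((1 / 7 : ℝ) : OnePoint ℝ), 3)]) ∧
    (∀ d, HasVeechData (rhombusCover60 mutetrahedron.toDartMap.subdivide d) 4
      [(OnePoint.infty, 3), (((1 : ℝ) : OnePoint ℝ), 1)]) ∧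
    (∀ d, HasVeechData (rhombusCover120 octa4.toDartMap d) 4
      [(OnePoint.infty, 3), (((1 / 2 : ℝ) : OnePoint ℝ), 1)]) ∧
    (∀ d, HasVeechData (squareCover truncatedOcta8.toDartMap d) 15
      [(OnePoint.infty, 6), (((3 : ℝ) : OnePoint ℝ), 2), (((1 : ℝ) : OnePoint ℝ), 3),
        (((4 : ℝ) : OnePoint ℝ), 4)]) :=
  ⟨SquareTiled.MucubeCover.hasVeechData,
    SquareTiled.MuoctahedronCover.hasVeechData,
    SquareTiled.MutetrahedronCover.hasVeechData,
    SquareTiled.Octa4Cover.hasVeechData,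
    SquareTiled.TruncatedOcta8Cover.hasVeechData⟩
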